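/- Let $p,q$ be unknown probability distributions on $[n]=\{1,\dots,n\}$, let $\|p-q\|_1=\sum_i|p_i-q_i|$, and write $\mathrm{Pois}(\lambda)$ for a Poisson number with mean $\lambda$. **The test.** Given real parameters $n^{-1/12}<\varepsilon\le 2$, $m_1,m_2>0$ and $C>0$, draw four independent batches of independent samples: $S_1,S_2$ of $\mathrm{Pois}(m_1)$ samples from $p$ each, and $T_1,T_2$ of $\mathrm{Pois}(m_2)$ samples from $q$ each. Let $\hat X_i,\hat Y_i$ be the numbers of occurrences of $i$ in $S_1,T_1$, and $X_i,Y_i$ those in $S_2,T_2$. Put $b=\frac{256\log n}{\varepsilon^2m_2}$, $b'=\frac{256\log n}{m_2}$ and $$B=\{i:\hat X_i/m_1>b\}\cup\{i:\hat Y_i/m_2>b\},\quad M=\{i: b'\le\max\{\hat X_i/m_1,\hat Y_i/m_2\}\le b\},\quad H=[n]\setminus(B\cup M).$$ The test outputs ACCEPT if the three inequalities $$V_B:=\sum_{i\in B}\Big|\frac{X_i}{m_1}-\frac{Y_i}{m_2}\Big|\le\frac{\varepsilon}{6},\qquad W_M:=\sum_{i\in M}\Big((m_2X_i-m_1Y_i)^2-(m_2^2X_i+m_1^2Y_i)\Big)\le\frac{\varepsilon^2m_1^2m_2\log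 n}{2},$$ $$Z_H:=\sum_{i\in H}\frac{(m_2X_i-m_1Y_i)^2-(m_2^2X_i+m_1^2Y_i)}{X_i+Y_i}\le C\,m_1^{3/2}m_2$$ all hold (terms of $Z_H$ with $X_i+Y_i=0$ are $0$), and REJECT otherwise. **Proposition.** There is an absolute constant $C_2>0$, and for every $\gamma>0$ a constant $C_\gamma>0$, such that for every $K>0$ there is $n_0=n_0(\gamma,K)$ with the following property. Let $n\ge n_0$, $n^{-1/12}<\varepsilon\le2$, $$\frac{n^{2/3}}{\varepsilon^{4/3}}\le m_1\le\min\Big\{K\Big(\frac{n}{\varepsilon^2}\Big)^{1-\gamma},\,n\Big\},\qquad m_2=C_2\max\Big\{\frac{n}{\sqrt{m_1}\,\varepsilon^2},\frac{\sqrt n}{\varepsilon^2}\Big\}.$$ Then, for all distributions $p,q$ on $[n]$, with probability at least $2/3$ the test run with $C=C_\gamma$ satisfies all of the following simultaneously: it draws at least $m_1$ and at most $3m_1$ samples from $p$ in total, and at most $3m_2$ samples from $q$ in total; if $p=q$, it outputs ACCEPT; if $\|p-q\|_1\ge\varepsilon$, it outputs REJECT. -/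

import Mathlib

open scoped BigOperators NNReal ENNReal

namespace ClosenessTest

noncomputable section

/-- The law of a list of `k` independent draws from `p`. -/
def iidSample {α : Type*} (p : PMF α) : ℕ → PMF (List α)
  | 0 => PMF.pure []
  | k + 1 => p.bind fun a => (iidSample p k).map fun l => a :: l

/-- The law of `Pois(r)` independent draws from `p`: first the number of draws is sampled from the
Poisson distribution with mean `r`, then that many independent draws from `p` are made. -/
def poissonSample {α : Type*} (p : PMF α) (r : ℝ≥0) : PMF (List α) :=
  (ProbabilityTheory.poissonMeasure r).toPMF.bind fun k => iidSample p k

/-- The data on which the test is run: two batches `S₁`, `S₂` of samples from `p` and two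
batches `T₁`, `T₂` of samples from `q`. -/
structure Samples (n : ℕ) where
  S₁ : List (Fin n)
  S₂ : List (Fin n)
  T₁ : List (Fin n)
  T₂ : List (Fin n)

/-- The law of the data: `S₁`, `S₂`, `T₁`, `T₂` are independent, `S₁` and `S₂` consist of
`Pois(m₁)` draws from `p` each, `T₁` and `T₂` of `Pois(m₂)` draws from `q` each. -/
def samplesLaw {n : ℕ} (p q : PMF (Fin n)) (m₁ m₂ : ℝ) : PMF (Samples n) :=
  (poissonSample p m₁.toNNReal).bind fun S₁ =>
  (poissonSample p m₁.toNNReal).bind fun S₂ =>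
  (poissonSample q m₂.toNNReal).bind fun T₁ =>
  (poissonSample q m₂.toNNReal).map fun T₂ => ⟨S₁, S₂, T₁, T₂⟩

/-- The probability of the event `E` under the discrete law `P`. -/
def prob {Ω : Type*} (P : PMF Ω) (E : Set Ω) : ℝ≥0∞ := P.toOuterMeasure E

/-- The number of occurrences of `i` in the sample `S`, as a real number. -/
def occ {n : ℕ} (S : List (Fin n)) (i : Fin n) : ℝ := (S.count i : ℝ)

/-- The upper threshold `b = 256 log n / (ε² m₂)`. -/
def thrB (n : ℕ) (ε m₂ : ℝ) : ℝ := 256 * Real.log n / (ε ^ 2 * m₂)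

/-- The lower threshold `b' = 256 log n / m₂`. -/
def thrB' (n : ℕ) (m₂ : ℝ) : ℝ := 256 * Real.log n / m₂

open Classical in
/-- The heavy set. -/
def heavySet {n : ℕ} (ε m₁ m₂ : ℝ) (ω : Samples n) : Finset (Fin n) :=
  Finset.univ.filter (fun i => occ ω.S₁ i / m₁ > thrB n ε m₂) ∪
    Finset.univ.filter (fun i => occ ω.T₁ i / m₂ > thrB n ε m₂)

open Classical in
/-- The medium set. -/
def mediumSet {n : ℕ} (ε m₁ m₂ : ℝ) (ω : Samples n) : Finset (Fin n) :=
  Finset.univ.filter fun i => thrB' n m₂ ≤ max (occ ω.S₁ i / m₁) (occ ω.T₁ i / m₂) ∧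
    max (occ ω.S₁ i / m₁) (occ ω.T₁ i / m₂) ≤ thrB n ε m₂

open Classical in
/-- The light set: all remaining elements. -/
def lightSet {n : ℕ} (ε m₁ m₂ : ℝ) (ω : Samples n) : Finset (Fin n) :=
  Finset.univ \ (heavySet ε m₁ m₂ ω ∪ mediumSet ε m₁ m₂ ω)

/-- The statistic `V_B`. -/
def statV {n : ℕ} (ε m₁ m₂ : ℝ) (ω : Samples n) : ℝ :=
  ∑ i ∈ heavySet ε m₁ m₂ ω, |occ ω.S₂ i / m₁ - occ ω.T₂ i / m₂|

/-- The statistic `W_M`. -/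
def statW {n : ℕ} (ε m₁ m₂ : ℝ) (ω : Samples n) : ℝ :=
  ∑ i ∈ mediumSet ε m₁ m₂ ω,
    ((m₂ * occ ω.S₂ i - m₁ * occ ω.T₂ i) ^ 2 - (m₂ ^ 2 * occ ω.S₂ i + m₁ ^ 2 * occ ω.T₂ i))

/-- The statistic `Z_H`. An element that occurs in neither `S₂` nor `T₂` contributes `0 / 0 = 0`. -/
def statZ {n : ℕ} (ε m₁ m₂ : ℝ) (ω : Samples n) : ℝ :=
  ∑ i ∈ lightSet ε m₁ m₂ ω,
    ((m₂ * occ ω.S₂ i - m₁ * occ ω.T₂ i) ^ 2 - (m₂ ^ 2 * occ ω.S₂ i + m₁ ^ 2 * occ ω.T₂ i)) /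
      (occ ω.S₂ i + occ ω.T₂ i)

/-- The test, with constant `C` in its third check, outputs ACCEPT on the data `ω`; otherwise it
outputs REJECT. -/
def Accepts {n : ℕ} (C ε m₁ m₂ : ℝ) (ω : Samples n) : Prop :=
  statV ε m₁ m₂ ω ≤ ε / 6 ∧
  statW ε m₁ m₂ ω ≤ ε ^ 2 * m₁ ^ 2 * m₂ * Real.log n / 2 ∧
  statZ ε m₁ m₂ ω ≤ C * m₁ ^ (3 / 2 : ℝ) * m₂

/-- The total number of samples drawn from `p`. -/
def Samples.numP {n : ℕ} (ω : Samples n) : ℕ := ω.S₁.length + ω.S₂.length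

/-- The total number of samples drawn from `q`. -/
def Samples.numQ {n : ℕ} (ω : Samples n) : ℕ := ω.T₁.length + ω.T₂.length

/-- The distance `‖p - q‖₁`. -/
def l1Dist {n : ℕ} (p q : PMF (Fin n)) : ℝ := ∑ i, |(p i).toReal - (q i).toReal|

/-- The quantity `max {n / (√m₁ ε²), √n / ε²}`. -/
def qRate (n : ℕ) (ε m₁ : ℝ) : ℝ :=
  max (n / (Real.sqrt m₁ * ε ^ 2)) (Real.sqrt n / ε ^ 2)

end

end ClosenessTest

open MeasureTheory ProbabilityTheory

namespace ClosenessTest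

/-! Poissonization makes the counts of one pair of batches independent Poisson numbers with means
`m₁ pᵢ` and `m₂ qᵢ`; the data seen through counts are two independent copies `u`, `v` of `pairLaw`
(`samplesLaw_map_data`). Conditionally on `u` the sets `B`, `M`, `H` are fixed, so each statistic is
a sum of independent terms in `v`, and Markov's or Chebyshev's inequality suffices.

Only two global properties of `u` are needed, and no concentration for individual elements. Totals
close to their means give `|B| ≤ 4/b` and `|M| ≤ 4/b'`. A total squared frequency error below `b`
gives `∑_M (pᵢ² + qᵢ²) ≤ 8b` (`sum_medium_sq_le`).

For fixed sets, `V` differs from the L1 distance on `B` by at most the absolute error there, which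
is small because `B` is small. `W` has mean `(m₁m₂)² ∑_M (pᵢ - qᵢ)²`, which Cauchy-Schwarz and the
size of `M` bound below. `Z` has a mean at least `R = ∑_H (m₁m₂(pᵢ - qᵢ))² / (m₁pᵢ + m₂qᵢ + 2)`, and
its variance is at most a null part plus a multiple of `R` (`ratioStat_moments`); `R` is bounded
below by Cauchy-Schwarz again. If `p = q` the means of `W` and `Z` vanish and `V` is pure error. If
the distance is at least `ε`, one of the three sets carries at least `ε/3` of it and the matching
check fails.

All moments come from the identity `E[X g(X)] = r E[g(X + 1)]` for a Poisson number of mean `r`,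
which also handles the division by `X + Y` (`factorialMoment`). -/

/-- The vector of occurrence counts of a sample. -/
def counts {α : Type*} [DecidableEq α] (l : List α) : α → ℕ := fun i => l.count i

/-! ### Poissonization: the counts of one batch are independent Poisson numbers. -/

section Counts

variable {α : Type*} [DecidableEq α]

lemma counts_cons (a : α) (l : List α) : counts (a :: l) = counts l + Pi.single a 1 := by
  funext i
  by_cases h : a = i
  · subst h; simp [counts]
  · simp [counts, h, Ne.symm h]

lemma sum_counts [Fintype α] (l : List α) : ∑ i, counts l i = l.length := by
  induction l with
  | nil => simp [counts]
  | cons a l ih => simp [counts_cons, Finset.sum_add_distrib, ih]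

lemma map_add_single_apply (P : PMF (α → ℕ)) (a : α) (c : α → ℕ) :
    (P.map fun d => d + Pi.single a 1) c =
      if c a = 0 then 0 else P (c - Pi.single a 1) := by
  rw [PMF.map_apply]
  split_ifs with h
  · rw [ENNReal.tsum_eq_zero]
    intro d
    rw [if_neg]
    rintro rfl
    simp at h
  · have hc : c = (c - Pi.single a 1) + Pi.single a 1 := by
      funext i
      by_cases hi : i = a
      · subst hi; simp; omega
      · simp [hi]
    rw [tsum_eq_single (c - Pi.single a 1), if_pos hc]
    intro d hd
    rw [if_neg]
    rintro rfl
    exact hd (by simp)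

variable [Fintype α]

/-- The multinomial weight of a vector of counts, up to the factorial of the sample size. -/
noncomputable def countWeight (p : PMF α) (c : α → ℕ) : ℝ≥0∞ :=
  ∏ i, (p i ^ c i * ((c i).factorial : ℝ≥0∞)⁻¹)

/-- The recursion behind the multinomial law: only the factor at `a` changes, by `p a / c a`. -/
lemma mul_countWeight_sub_single (p : PMF α) (c : α → ℕ) (a : α) (h : c a ≠ 0) :
    p a * countWeight p (c - Pi.single a 1) = c a * countWeight p c := by
  unfold countWeight
  rw [← Finset.mul_prod_erase _ _ (Finset.mem_univ a), ← Finset.mul_prod_erase _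
    (fun i => p i ^ c i * ((c i).factorial : ℝ≥0∞)⁻¹) (Finset.mem_univ a)]
  have h1 : ∏ i ∈ Finset.univ.erase a, (p i ^ (c - Pi.single a 1 : α → ℕ) i *
      (((c - Pi.single a 1 : α → ℕ) i).factorial : ℝ≥0∞)⁻¹) =
      ∏ i ∈ Finset.univ.erase a, (p i ^ c i * ((c i).factorial : ℝ≥0∞)⁻¹) := by
    refine Finset.prod_congr rfl fun i hi => ?_
    have : i ≠ a := Finset.ne_of_mem_erase hi
    simp [this]
  rw [h1, ← mul_assoc, ← mul_assoc (c a : ℝ≥0∞)]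
  congr 1
  obtain ⟨m, hm⟩ := Nat.exists_eq_succ_of_ne_zero h
  have hm' : (c - Pi.single a 1 : α → ℕ) a = m := by simp [hm]
  rw [hm', hm, Nat.factorial_succ, pow_succ]
  push_cast
  rw [ENNReal.mul_inv (Or.inr (by simp)) (Or.inr (by simp [Nat.factorial_ne_zero]))]
  have h2 : ((m : ℝ≥0∞) + 1) * ((m : ℝ≥0∞) + 1)⁻¹ = 1 :=
    ENNReal.mul_inv_cancel (by simp) (by finiteness)
  calc p a * (p a ^ m * (m.factorial : ℝ≥0∞)⁻¹)
      = (((m : ℝ≥0∞) + 1) * ((m : ℝ≥0∞) + 1)⁻¹) *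
          (p a ^ m * p a * (m.factorial : ℝ≥0∞)⁻¹) := by rw [h2]; ring
    _ = _ := by ring

/-- Conditioning on the first draw `a` gives the weight of `c` with one `a` removed, hence a
contribution proportional to `c a`; summing over `a` yields the factor `k + 1` that advances the
factorial. -/
lemma iidSample_map_counts_apply (p : PMF α) (k : ℕ) (c : α → ℕ) :
    ((iidSample p k).map counts) c =
      if ∑ i, c i = k then (k.factorial : ℝ≥0∞) * countWeight p c else 0 := by
  induction k generalizing c with
  | zero =>
    rw [iidSample, PMF.pure_map, PMF.pure_apply]
    have h0 : counts ([] : List α) = 0 := by funext i; simp [counts]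
    rw [h0]
    by_cases h : c = 0
    · subst h; simp [countWeight]
    · have : ∑ i, c i ≠ 0 := by
        intro h'
        exact h (funext fun i => by simpa using Finset.sum_eq_zero_iff.1 h' i (Finset.mem_univ i))
      rw [if_neg h, if_neg this]
  | succ k ih =>
    have h1 : (iidSample p (k + 1)).map counts =
        p.bind fun a => ((iidSample p k).map counts).map fun d => d + Pi.single a 1 := by
      rw [iidSample, PMF.map_bind]
      congr 1
      funext a
      rw [PMF.map_comp, PMF.map_comp]
      congr 1
      funext l
      exact counts_cons a l
    rw [h1, PMF.bind_apply, tsum_fintype]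
    have h2 : ∀ a, p a * (((iidSample p k).map counts).map fun d => d + Pi.single a 1) c =
        if ∑ i, c i = k + 1 then (k.factorial : ℝ≥0∞) * (c a * countWeight p c) else 0 := by
      intro a
      rw [map_add_single_apply]
      by_cases ha : c a = 0
      · simp [ha]
      rw [if_neg ha, ih]
      have hs : ∑ i, c i = ∑ i, (c - Pi.single a 1 : α → ℕ) i + 1 := by
        have hc : c = (c - Pi.single a 1) + Pi.single a 1 := by
          funext i
          by_cases hi : i = a
          · subst hi; simp; omega
          · simp [hi]
        conv_lhs => rw [hc]
        simp [Finset.sum_add_distrib]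
      have : (∑ i, (c - Pi.single a 1 : α → ℕ) i = k) ↔ (∑ i, c i = k + 1) := by omega
      simp only [this]
      split_ifs
      · rw [← mul_countWeight_sub_single p c a ha]; ring
      · simp
    simp only [h2]
    split_ifs with h
    · rw [← Finset.mul_sum, ← Finset.sum_mul, ← Nat.cast_sum, h, Nat.factorial_succ]
      push_cast; ring
    · simp

/-- The law of the vector of counts of a Poissonized sample: independent Poisson numbers. -/
lemma poissonSample_map_counts_apply (p : PMF α) (r : ℝ≥0) (c : α → ℕ) :
    ((poissonSample p r).map counts) c =
      Measure.pi (fun i => poissonMeasure (r * (p i).toNNReal)) {c} := by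
  -- Only the sample size equal to the total of `c` contributes, and `exp (-r)` factors over the
  -- elements because `p` has mass one.
  rw [Measure.pi_singleton, poissonSample, PMF.map_bind, PMF.bind_apply,
    tsum_eq_single (∑ i, c i)]
  · rw [iidSample_map_counts_apply, if_pos rfl, Measure.toPMF_apply, poissonMeasure_singleton]
    simp only [poissonMeasure_singleton]
    set P : α → ℝ := fun i => (p i).toReal with hP
    have hp : ∀ i, p i = ENNReal.ofReal (P i) := fun i =>
      (ENNReal.ofReal_toReal (p.apply_ne_top i)).symm
    have hP0 : ∀ i, 0 ≤ P i := fun i => ENNReal.toReal_nonneg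
    have hP1 : ∑ i, P i = 1 := by
      have := p.tsum_coe
      rw [tsum_fintype] at this
      rw [hP, ← ENNReal.toReal_sum (fun i _ => p.apply_ne_top i), this]; simp
    have hw : countWeight p c = ENNReal.ofReal (∏ i, (P i ^ c i * ((c i).factorial : ℝ)⁻¹)) := by
      rw [countWeight, ENNReal.ofReal_prod_of_nonneg (fun i _ => by have := hP0 i; positivity)]
      refine Finset.prod_congr rfl fun i _ => ?_
      rw [ENNReal.ofReal_mul (by have := hP0 i; positivity), ENNReal.ofReal_pow (hP0 i), ← hp,
        ENNReal.ofReal_inv_of_pos (by positivity), ENNReal.ofReal_natCast]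
    have hfac : (((∑ i, c i).factorial : ℕ) : ℝ≥0∞) =
        ENNReal.ofReal ((∑ i, c i).factorial : ℝ) := by simp
    rw [hw, hfac, ← ENNReal.ofReal_prod_of_nonneg (fun i _ => by positivity),
      ← ENNReal.ofReal_mul (by positivity), ← ENNReal.ofReal_mul (by positivity)]
    congr 1
    have hterm : ∀ i, Real.exp (-((r * (p i).toNNReal : ℝ≥0) : ℝ)) *
        ((r * (p i).toNNReal : ℝ≥0) : ℝ) ^ c i / ((c i).factorial : ℝ) =
        Real.exp (-(r * P i)) * ((r : ℝ) ^ c i * (P i ^ c i * ((c i).factorial : ℝ)⁻¹)) := by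
      intro i
      have : (((p i).toNNReal : ℝ≥0) : ℝ) = P i := rfl
      rw [NNReal.coe_mul, this, mul_pow]
      ring
    simp only [hterm, Finset.prod_mul_distrib, ← Real.exp_sum, Finset.prod_pow_eq_pow_sum]
    rw [Finset.sum_neg_distrib, ← Finset.mul_sum, hP1, mul_one]
    have : ((∑ i, c i).factorial : ℝ) ≠ 0 := by positivity
    field_simp
  · intro k hk
    rw [iidSample_map_counts_apply, if_neg (Ne.symm hk), mul_zero]

end Counts

/-! ### The law of all four batches as a product of two identical pair laws. -/

section Data

variable {n : ℕ}

/-- The law of one pair of batches, seen through the pairs of counts. -/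
noncomputable def pairLaw (p q : PMF (Fin n)) (m₁ m₂ : ℝ) : Measure (Fin n → ℕ × ℕ) :=
  Measure.pi fun i => (poissonMeasure (m₁.toNNReal * (p i).toNNReal)).prod
    (poissonMeasure (m₂.toNNReal * (q i).toNNReal))

instance (p q : PMF (Fin n)) (m₁ m₂ : ℝ) : IsProbabilityMeasure (pairLaw p q m₁ m₂) := by
  unfold pairLaw; infer_instance

/-- The counts in the first and in the second pair of batches. -/
def Samples.data (ω : Samples n) : (Fin n → ℕ × ℕ) × (Fin n → ℕ × ℕ) :=
  (fun i => (counts ω.S₁ i, counts ω.T₁ i), fun i => (counts ω.S₂ i, counts ω.T₂ i))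

lemma pairLaw_singleton (p q : PMF (Fin n)) (m₁ m₂ : ℝ) (z : Fin n → ℕ × ℕ) :
    pairLaw p q m₁ m₂ {z} =
      ((poissonSample p m₁.toNNReal).map counts) (fun i => (z i).1) *
      ((poissonSample q m₂.toNNReal).map counts) (fun i => (z i).2) := by
  rw [poissonSample_map_counts_apply, poissonSample_map_counts_apply, pairLaw,
    Measure.pi_singleton, Measure.pi_singleton, Measure.pi_singleton, ← Finset.prod_mul_distrib]
  refine Finset.prod_congr rfl fun i _ => ?_
  rw [← Measure.prod_prod, Set.singleton_prod_singleton]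

lemma samplesLaw_map_data (p q : PMF (Fin n)) (m₁ m₂ : ℝ) :
    ((samplesLaw p q m₁ m₂).map Samples.data).toMeasure =
      (pairLaw p q m₁ m₂).prod (pairLaw p q m₁ m₂) := by
  refine Measure.ext_of_singleton fun z => ?_
  obtain ⟨u, v⟩ := z
  rw [PMF.toMeasure_apply_singleton _ _ (measurableSet_singleton _),
    ← Set.singleton_prod_singleton, Measure.prod_prod, pairLaw_singleton, pairLaw_singleton]
  set P := (poissonSample p m₁.toNNReal).map counts with hP
  set Q := (poissonSample q m₂.toNNReal).map counts with hQ
  have h : (samplesLaw p q m₁ m₂).map Samples.data =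
      P.bind fun x₁ => P.bind fun x₂ => Q.bind fun y₁ => Q.bind fun y₂ =>
        PMF.pure (fun i => (x₁ i, y₁ i), fun i => (x₂ i, y₂ i)) := by
    simp only [samplesLaw, hP, hQ, PMF.map_bind, PMF.bind_map, PMF.map_comp, Function.comp_def]
    rfl
  -- Each of the four nested sums collapses to the single count vector prescribed by the target
  -- point.
  rw [h, PMF.bind_apply, tsum_eq_single (fun i => (u i).1), PMF.bind_apply,
    tsum_eq_single (fun i => (v i).1), PMF.bind_apply, tsum_eq_single (fun i => (u i).2),
    PMF.bind_apply, tsum_eq_single (fun i => (v i).2)]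
  · simp only [Prod.mk.eta, PMF.pure_apply_self]; ring
  · intro y hy
    rw [PMF.pure_apply_of_ne, mul_zero]
    rintro h; simp only [Prod.mk.injEq, funext_iff] at h
    exact hy (funext fun i => by rw [h.2 i])
  all_goals
    intro y hy
    rw [mul_eq_zero]
    right
    simp only [PMF.bind_apply, ENNReal.tsum_eq_zero, mul_eq_zero]
  · intro y₂
    right
    rw [PMF.pure_apply_of_ne]
    rintro h; simp only [Prod.mk.injEq, funext_iff] at h
    exact hy (funext fun i => by rw [h.1 i])
  · intro y₁
    right
    intro y₂
    right
    rw [PMF.pure_apply_of_ne]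
    rintro h; simp only [Prod.mk.injEq, funext_iff] at h
    exact hy (funext fun i => by rw [h.2 i])
  · intro x₂
    right
    intro y₁
    right
    intro y₂
    right
    rw [PMF.pure_apply_of_ne]
    rintro h; simp only [Prod.mk.injEq, funext_iff] at h
    exact hy (funext fun i => by rw [h.1 i])

lemma prob_samplesLaw (p q : PMF (Fin n)) (m₁ m₂ : ℝ)
    (E : Set ((Fin n → ℕ × ℕ) × (Fin n → ℕ × ℕ))) :
    prob (samplesLaw p q m₁ m₂) (Samples.data ⁻¹' E) =
      ((pairLaw p q m₁ m₂).prod (pairLaw p q m₁ m₂)) E := by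
  rw [← samplesLaw_map_data, prob, ← PMF.toOuterMeasure_map_apply,
    PMF.toMeasure_apply_eq_toOuterMeasure]

end Data

/-! ### Factorial moments of a pair of Poisson numbers, weighted by a function of the sum. -/

section PoissonPair

/-- The law of a pair of independent Poisson numbers. -/
noncomputable def poissonPair (r s : ℝ≥0) : Measure (ℕ × ℕ) :=
  (poissonMeasure r).prod (poissonMeasure s)

instance (r s : ℝ≥0) : IsProbabilityMeasure (poissonPair r s) := by
  unfold poissonPair; infer_instance

variable (r s : ℝ≥0)

lemma succ_mul_poissonMeasure_singleton (k : ℕ) :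
    ((k + 1 : ℕ) : ℝ≥0∞) * poissonMeasure r {k + 1} = r * poissonMeasure r {k} := by
  rw [poissonMeasure_singleton, poissonMeasure_singleton, ← ENNReal.ofReal_natCast,
    ← ENNReal.ofReal_coe_nnreal, ← ENNReal.ofReal_mul (by positivity),
    ← ENNReal.ofReal_mul (by positivity)]
  congr 1
  rw [Nat.factorial_succ]
  push_cast
  field_simp
  ring

lemma poissonPair_singleton (z : ℕ × ℕ) :
    poissonPair r s {z} = poissonMeasure r {z.1} * poissonMeasure s {z.2} := by
  rw [poissonPair, ← Measure.prod_prod, Set.singleton_prod_singleton]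

/-- The size-bias (Stein-Chen) identity `k P(k) = r P(k - 1)`. Stated for measures, it transfers
integrability as well as integrals, so `integral_fst_mul` holds for every `g`. -/
lemma poissonPair_withDensity_fst :
    (poissonPair r s).withDensity (fun z => ((z.1 : ℝ≥0) : ℝ≥0∞)) =
      r • (poissonPair r s).map (fun z => (z.1 + 1, z.2)) := by
  refine Measure.ext_of_singleton fun z => ?_
  obtain ⟨x, y⟩ := z
  rw [withDensity_apply _ (measurableSet_singleton _), lintegral_singleton, Measure.smul_apply,
    Measure.map_apply .of_discrete (measurableSet_singleton _), poissonPair_singleton]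
  cases x with
  | zero =>
    have : (fun z : ℕ × ℕ => (z.1 + 1, z.2)) ⁻¹' {(0, y)} = ∅ := by ext; simp
    simp [this]
  | succ k =>
    have : (fun z : ℕ × ℕ => (z.1 + 1, z.2)) ⁻¹' {(k + 1, y)} = {(k, y)} := by
      ext ⟨a, b⟩; simp
    rw [this, poissonPair_singleton, ENNReal.smul_def, smul_eq_mul]
    have := succ_mul_poissonMeasure_singleton r k
    push_cast at this ⊢
    rw [← mul_assoc, this, mul_assoc]

lemma poissonPair_withDensity_snd :
    (poissonPair r s).withDensity (fun z => ((z.2 : ℝ≥0) : ℝ≥0∞)) =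
      s • (poissonPair r s).map (fun z => (z.1, z.2 + 1)) := by
  refine Measure.ext_of_singleton fun z => ?_
  obtain ⟨x, y⟩ := z
  rw [withDensity_apply _ (measurableSet_singleton _), lintegral_singleton, Measure.smul_apply,
    Measure.map_apply .of_discrete (measurableSet_singleton _), poissonPair_singleton]
  cases y with
  | zero =>
    have : (fun z : ℕ × ℕ => (z.1, z.2 + 1)) ⁻¹' {(x, 0)} = ∅ := by ext; simp
    simp [this]
  | succ k =>
    have : (fun z : ℕ × ℕ => (z.1, z.2 + 1)) ⁻¹' {(x, k + 1)} = {(x, k)} := by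
      ext ⟨a, b⟩; simp
    rw [this, poissonPair_singleton, ENNReal.smul_def, smul_eq_mul]
    have := succ_mul_poissonMeasure_singleton s k
    push_cast at this ⊢
    rw [mul_left_comm, this, mul_left_comm]

variable {r s}

lemma integral_fst_mul (g : ℕ × ℕ → ℝ) :
    ∫ z, (z.1 : ℝ) * g z ∂poissonPair r s = r * ∫ z, g (z.1 + 1, z.2) ∂poissonPair r s := by
  have h := integral_withDensity_eq_integral_smul (μ := poissonPair r s)
    (f := fun z => (z.1 : ℝ≥0)) .of_discrete g
  rw [poissonPair_withDensity_fst, integral_smul_nnreal_measure,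
    integral_map .of_discrete .of_discrete] at h
  simpa [NNReal.smul_def] using h.symm

lemma integral_snd_mul (g : ℕ × ℕ → ℝ) :
    ∫ z, (z.2 : ℝ) * g z ∂poissonPair r s = s * ∫ z, g (z.1, z.2 + 1) ∂poissonPair r s := by
  have h := integral_withDensity_eq_integral_smul (μ := poissonPair r s)
    (f := fun z => (z.2 : ℝ≥0)) .of_discrete g
  rw [poissonPair_withDensity_snd, integral_smul_nnreal_measure,
    integral_map .of_discrete .of_discrete] at h
  simpa [NNReal.smul_def] using h.symm

lemma integrable_fst_mul {g : ℕ × ℕ → ℝ}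
    (hg : Integrable (fun z => g (z.1 + 1, z.2)) (poissonPair r s)) :
    Integrable (fun z => (z.1 : ℝ) * g z) (poissonPair r s) := by
  have h := integrable_withDensity_iff_integrable_smul (μ := poissonPair r s)
    (f := fun z => (z.1 : ℝ≥0)) .of_discrete (g := g)
  have h2 : Integrable g ((poissonPair r s).map (fun z => (z.1 + 1, z.2))) :=
    (integrable_map_measure .of_discrete .of_discrete).2 hg
  rw [poissonPair_withDensity_fst] at h
  simpa [NNReal.smul_def] using h.1 (h2.smul_measure_nnreal)

lemma integrable_snd_mul {g : ℕ × ℕ → ℝ}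
    (hg : Integrable (fun z => g (z.1, z.2 + 1)) (poissonPair r s)) :
    Integrable (fun z => (z.2 : ℝ) * g z) (poissonPair r s) := by
  have h := integrable_withDensity_iff_integrable_smul (μ := poissonPair r s)
    (f := fun z => (z.2 : ℝ≥0)) .of_discrete (g := g)
  have h2 : Integrable g ((poissonPair r s).map (fun z => (z.1, z.2 + 1))) :=
    (integrable_map_measure .of_discrete .of_discrete).2 hg
  rw [poissonPair_withDensity_snd] at h
  simpa [NNReal.smul_def] using h.1 (h2.smul_measure_nnreal)

/-- `f` is integrable with integral `v`. -/
def HasIntegral {Ω : Type*} [MeasurableSpace Ω] (P : Measure Ω) (f : Ω → ℝ) (v : ℝ) : Prop :=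
  Integrable f P ∧ ∫ z, f z ∂P = v

section HasIntegral

variable {Ω : Type*} [MeasurableSpace Ω] {P : Measure Ω} {f g : Ω → ℝ} {u v : ℝ}

lemma HasIntegral.add (hf : HasIntegral P f u) (hg : HasIntegral P g v) :
    HasIntegral P (fun z => f z + g z) (u + v) :=
  ⟨hf.1.add hg.1, by rw [integral_add hf.1 hg.1, hf.2, hg.2]⟩

lemma HasIntegral.const_mul (hf : HasIntegral P f u) (c : ℝ) :
    HasIntegral P (fun z => c * f z) (c * u) :=
  ⟨hf.1.const_mul c, by rw [integral_const_mul, hf.2]⟩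

lemma HasIntegral.congr (hf : HasIntegral P f u) (h : ∀ z, g z = f z) (huv : v = u) :
    HasIntegral P g v := by
  obtain rfl : g = f := funext h
  rwa [huv]

end HasIntegral

lemma integrable_of_bounded_sum {φ : ℕ → ℝ} {C : ℝ} (hφ : ∀ k, |φ k| ≤ C) (c : ℕ) :
    Integrable (fun z => φ (z.1 + z.2 + c)) (poissonPair r s) :=
  Integrable.of_bound (AEStronglyMeasurable.of_discrete) C (.of_forall fun _ => hφ _)

lemma factorialMoment_snd {φ : ℕ → ℝ} {C : ℝ} (hφ : ∀ k, |φ k| ≤ C) (b c : ℕ) :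
    HasIntegral (poissonPair r s) (fun z => (z.2.descFactorial b : ℝ) * φ (z.1 + z.2 + c))
      (s ^ b * ∫ z, φ (z.1 + z.2 + (b + c)) ∂poissonPair r s) := by
  induction b generalizing c with
  | zero => exact ⟨by simpa using integrable_of_bounded_sum hφ c, by simp⟩
  | succ b ih =>
    -- The truncated subtraction is harmless: at `z.2 = 0` the factor in front vanishes.
    have e : (fun z : ℕ × ℕ => (z.2.descFactorial (b + 1) : ℝ) * φ (z.1 + z.2 + c)) =
        fun z => (z.2 : ℝ) * (((z.2 - 1).descFactorial b : ℝ) * φ (z.1 + z.2 + c)) := by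
      funext ⟨x, y⟩
      cases y with
      | zero => simp
      | succ y => rw [Nat.succ_descFactorial_succ]; simp [mul_assoc]
    have e2 : (fun z : ℕ × ℕ => ((z.2 + 1 - 1).descFactorial b : ℝ) * φ (z.1 + (z.2 + 1) + c)) =
        fun z => (z.2.descFactorial b : ℝ) * φ (z.1 + z.2 + (c + 1)) := by
      funext z
      rw [Nat.add_sub_cancel, show z.1 + (z.2 + 1) + c = z.1 + z.2 + (c + 1) by ring]
    rw [e]
    constructor
    · apply integrable_snd_mul
      rw [e2]
      exact (ih (c + 1)).1
    · rw [integral_snd_mul, e2, (ih (c + 1)).2, pow_succ', mul_assoc]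
      simp only [show b + (c + 1) = b + 1 + c by ring]

/-- Each factor removed by the size-bias identity shifts the argument of `φ` by one. Taking `φ`
constant serves `W`, and `φ k = 1 / k` or its square serves `Z`. -/
lemma factorialMoment {φ : ℕ → ℝ} {C : ℝ} (hφ : ∀ k, |φ k| ≤ C) (a b c : ℕ) :
    HasIntegral (poissonPair r s) (fun z => (z.1.descFactorial a : ℝ) *
      ((z.2.descFactorial b : ℝ) * φ (z.1 + z.2 + c)))
      (r ^ a * s ^ b * ∫ z, φ (z.1 + z.2 + (a + b + c)) ∂poissonPair r s) := by
  induction a generalizing c with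
  | zero => simpa using factorialMoment_snd hφ b c
  | succ a ih =>
    have e : (fun z : ℕ × ℕ => (z.1.descFactorial (a + 1) : ℝ) * ((z.2.descFactorial b : ℝ) *
        φ (z.1 + z.2 + c))) = fun z => (z.1 : ℝ) * (((z.1 - 1).descFactorial a : ℝ) *
          ((z.2.descFactorial b : ℝ) * φ (z.1 + z.2 + c))) := by
      funext ⟨x, y⟩
      cases x with
      | zero => simp
      | succ y => rw [Nat.succ_descFactorial_succ]; simp [mul_assoc]
    have e2 : (fun z : ℕ × ℕ => ((z.1 + 1 - 1).descFactorial a : ℝ) *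
        ((z.2.descFactorial b : ℝ) * φ (z.1 + 1 + z.2 + c))) =
        fun z => (z.1.descFactorial a : ℝ) *
          ((z.2.descFactorial b : ℝ) * φ (z.1 + z.2 + (c + 1))) := by
      funext z
      rw [Nat.add_sub_cancel, show z.1 + 1 + z.2 + c = z.1 + z.2 + (c + 1) by ring]
    rw [e]
    constructor
    · apply integrable_fst_mul
      rw [e2]
      exact (ih (c + 1)).1
    · rw [integral_fst_mul, e2, (ih (c + 1)).2, pow_succ' (r : ℝ), mul_assoc, mul_assoc, mul_assoc]
      simp only [show a + b + (c + 1) = a + 1 + b + c by ring]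

/-- The unbiased estimator of `(a r - b s) ^ 2` from a pair of Poisson numbers. -/
def quadStat (a b : ℝ) (z : ℕ × ℕ) : ℝ :=
  (a * z.1 - b * z.2) ^ 2 - (a ^ 2 * z.1 + b ^ 2 * z.2)

lemma cast_descFactorial_succ (x k : ℕ) :
    (x.descFactorial (k + 1) : ℝ) = ((x : ℝ) - k) * x.descFactorial k := by
  rw [Nat.descFactorial_succ, Nat.cast_mul]
  rcases le_or_gt k x with h | h
  · rw [Nat.cast_sub h]
  · rw [Nat.descFactorial_eq_zero_iff_lt.2 h]; simp

/-- The subtracted linear term turns the squares into factorial powers: `quadStat` is `a² X(X-1) +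
b² Y(Y-1) - 2ab XY`, homogeneous of factorial degree two. -/
lemma integral_quadStat {φ : ℕ → ℝ} {C : ℝ} (hφ : ∀ k, |φ k| ≤ C) (a b : ℝ) :
    HasIntegral (poissonPair r s) (fun z => quadStat a b z * φ (z.1 + z.2))
      ((a * r - b * s) ^ 2 * ∫ z, φ (z.1 + z.2 + 2) ∂poissonPair r s) := by
  have h20 := factorialMoment (r := r) (s := s) hφ 2 0 0
  have h11 := factorialMoment (r := r) (s := s) hφ 1 1 0
  have h02 := factorialMoment (r := r) (s := s) hφ 0 2 0
  have h := ((h20.const_mul (a ^ 2)).add (h02.const_mul (b ^ 2))).add (h11.const_mul (-2 * a * b))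
  refine h.congr (fun z => ?_) ?_
  · simp only [cast_descFactorial_succ, Nat.descFactorial_zero, quadStat, add_zero]
    push_cast
    ring
  · simp only [add_zero, zero_add, Nat.reduceAdd]
    ring

lemma integral_quadStat_sq {φ : ℕ → ℝ} {C : ℝ} (hφ : ∀ k, |φ k| ≤ C) (a b : ℝ) :
    HasIntegral (poissonPair r s) (fun z => quadStat a b z ^ 2 * φ (z.1 + z.2))
      ((a * r - b * s) ^ 4 * ∫ z, φ (z.1 + z.2 + 4) ∂poissonPair r s +
      4 * (a ^ 2 * r + b ^ 2 * s) * (a * r - b * s) ^ 2 *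
        ∫ z, φ (z.1 + z.2 + 3) ∂poissonPair r s +
      2 * (a ^ 2 * r + b ^ 2 * s) ^ 2 * ∫ z, φ (z.1 + z.2 + 2) ∂poissonPair r s) := by
  have h := fun i j => factorialMoment (r := r) (s := s) hφ i j 0
  -- The squared statistic is expanded in factorial powers and grouped by total degree 4, 3, 2,
  -- which is the shift in `φ`.
  have h4 := ((((h 4 0).const_mul (a ^ 4)).add ((h 0 4).const_mul (b ^ 4))).add
    ((h 2 2).const_mul (6 * a ^ 2 * b ^ 2))).add
    (((h 3 1).const_mul (-4 * a ^ 3 * b)).add ((h 1 3).const_mul (-4 * a * b ^ 3)))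
  have h3 := (((h 3 0).const_mul (4 * a ^ 4)).add ((h 0 3).const_mul (4 * b ^ 4))).add
    (((h 2 1).const_mul (4 * a ^ 2 * b ^ 2 - 8 * a ^ 3 * b)).add
    ((h 1 2).const_mul (4 * a ^ 2 * b ^ 2 - 8 * a * b ^ 3)))
  have h2 := (((h 2 0).const_mul (2 * a ^ 4)).add ((h 0 2).const_mul (2 * b ^ 4))).add
    ((h 1 1).const_mul (4 * a ^ 2 * b ^ 2))
  refine ((h4.add h3).add h2).congr (fun z => ?_) ?_
  · simp only [cast_descFactorial_succ, Nat.descFactorial_zero, quadStat, add_zero]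
    push_cast
    ring
  · simp only [add_zero, zero_add, Nat.reduceAdd]
    ring

end PoissonPair

/-! ### Inverse moments of a Poisson sum, and mean and variance of the one-element statistics. -/

section InverseMoments

variable {r s : ℝ≥0}

lemma hasIntegral_fst_sub_sq :
    HasIntegral (poissonPair r s) (fun z => ((z.1 : ℝ) - r) ^ 2) r := by
  have h := fun i => factorialMoment (r := r) (s := s) (φ := fun _ => 1) (C := 1) (by simp) i 0 0
  refine (((h 2).add ((h 1).const_mul (1 - 2 * r))).add ((h 0).const_mul ((r : ℝ) ^ 2))).congr
    (fun z => ?_) ?_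
  · simp only [cast_descFactorial_succ, Nat.descFactorial_zero]
    push_cast
    ring
  · simp
    ring

lemma hasIntegral_snd_sub_sq :
    HasIntegral (poissonPair r s) (fun z => ((z.2 : ℝ) - s) ^ 2) s := by
  have h := fun i => factorialMoment (r := r) (s := s) (φ := fun _ => 1) (C := 1) (by simp) 0 i 0
  refine (((h 2).add ((h 1).const_mul (1 - 2 * s))).add ((h 0).const_mul ((s : ℝ) ^ 2))).congr
    (fun z => ?_) ?_
  · simp only [cast_descFactorial_succ, Nat.descFactorial_zero]
    push_cast
    ring
  · simp
    ring

lemma hasIntegral_fst : HasIntegral (poissonPair r s) (fun z => (z.1 : ℝ)) r := by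
  refine (factorialMoment (r := r) (s := s) (φ := fun _ => 1) (C := 1) (by simp) 1 0 0).congr
    (fun z => ?_) ?_ <;> simp

lemma hasIntegral_snd : HasIntegral (poissonPair r s) (fun z => (z.2 : ℝ)) s := by
  refine (factorialMoment (r := r) (s := s) (φ := fun _ => 1) (C := 1) (by simp) 0 1 0).congr
    (fun z => ?_) ?_ <;> simp

lemma hasIntegral_const (c : ℝ) : HasIntegral (poissonPair r s) (fun _ => c) c :=
  ⟨integrable_const c, by simp⟩

lemma HasIntegral.mono {Ω : Type*} [MeasurableSpace Ω] {P : Measure Ω} {f g : Ω → ℝ} {u v : ℝ}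
    (hf : HasIntegral P f u) (hg : HasIntegral P g v) (h : ∀ z, f z ≤ g z) : u ≤ v := by
  rw [← hf.2, ← hg.2]
  exact integral_mono hf.1 hg.1 h

/-- The size-bias identity for `X + Y`, obtained by adding those for `X` and `Y` without identifying
the law of the sum. -/
lemma sum_mul_integral (g : ℕ → ℝ) {C : ℝ} (hg : ∀ k, |g k| ≤ C) :
    HasIntegral (poissonPair r s) (fun z => ((z.1 + z.2 : ℕ) : ℝ) * g (z.1 + z.2))
      ((r + s) * ∫ z, g (z.1 + z.2 + 1) ∂poissonPair r s) := by
  refine ((factorialMoment hg 1 0 0).add (factorialMoment hg 0 1 0)).congr (fun z => ?_) ?_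
  · simp [add_mul]
  · simp [add_mul]

lemma inv_add_abs_le (c : ℝ) (hc : 1 ≤ c) (k : ℕ) : |1 / ((k : ℝ) + c)| ≤ 1 := by
  rw [abs_of_nonneg (by positivity), div_le_one (by positivity)]
  have : (0 : ℝ) ≤ k := Nat.cast_nonneg k
  linarith

lemma integral_inv_add_one_le :
    ((r : ℝ) + s) * ∫ z, 1 / (((z.1 + z.2 : ℕ) : ℝ) + 1) ∂poissonPair r s ≤ 1 := by
  -- With `g k = 1 / k` the left side is the probability of a nonzero sum, since `1 / 0 = 0`.
  have h := sum_mul_integral (r := r) (s := s) (fun k => 1 / (k : ℝ)) (C := 1) (by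
    intro k
    rcases Nat.eq_zero_or_pos k with rfl | hk
    · simp
    · rw [abs_of_nonneg (by positivity), div_le_one (by positivity)]
      exact_mod_cast hk)
  have := h.mono (hasIntegral_const 1) (fun z => by
    rw [mul_one_div]; exact div_self_le_one _)
  simpa using this

lemma integral_inv_mul_le :
    ((r : ℝ) + s) ^ 2 *
      ∫ z, 1 / ((((z.1 + z.2 : ℕ) : ℝ) + 1) * (((z.1 + z.2 : ℕ) : ℝ) + 2)) ∂poissonPair r s ≤ 1 := by
  have h := sum_mul_integral (r := r) (s := s) (fun k => 1 / ((k : ℝ) * ((k : ℝ) + 1))) (C := 1) (by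
    intro k
    rcases Nat.eq_zero_or_pos k with rfl | hk
    · simp
    · have : (1 : ℝ) ≤ k := by exact_mod_cast hk
      rw [abs_of_nonneg (by positivity), div_le_one (by positivity)]
      nlinarith)
  have h1 : Integrable (fun z : ℕ × ℕ => 1 / (((z.1 + z.2 : ℕ) : ℝ) + 1)) (poissonPair r s) :=
    integrable_of_bounded_sum (φ := fun k => 1 / ((k : ℝ) + 1)) (C := 1)
      (inv_add_abs_le 1 le_rfl) 0
  have h2 := h.mono ⟨h1, rfl⟩ (fun z => by
    rcases Nat.eq_zero_or_pos (z.1 + z.2) with h0 | h0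
    · simp only [h0]; norm_num
    · have : (0 : ℝ) < ((z.1 + z.2 : ℕ) : ℝ) := by exact_mod_cast h0
      exact le_of_eq (by field_simp))
  have h3 : (fun z : ℕ × ℕ => 1 / (((z.1 + z.2 + 1 : ℕ) : ℝ) * (((z.1 + z.2 + 1 : ℕ) : ℝ) + 1))) =
      fun z => 1 / ((((z.1 + z.2 : ℕ) : ℝ) + 1) * (((z.1 + z.2 : ℕ) : ℝ) + 2)) := by
    funext z
    push_cast
    ring_nf
  simp only [h3] at h2
  have h4 := integral_inv_add_one_le (r := r) (s := s)
  have h5 : (0 : ℝ) ≤ (r : ℝ) + s := by positivity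
  nlinarith [mul_le_mul_of_nonneg_left h2 h5]

/-- Jensen's inequality for `1 / x`, proved by integrating the tangent line at `r + s + 2`; the gap
is an explicit square over a positive quantity. -/
lemma inv_le_integral_inv :
    1 / ((r : ℝ) + s + 2) ≤ ∫ z, 1 / (((z.1 + z.2 + 2 : ℕ) : ℝ)) ∂poissonPair r s := by
  have hL : (0 : ℝ) < (r : ℝ) + s + 2 := by positivity
  have h1 : Integrable (fun z : ℕ × ℕ => 1 / (((z.1 + z.2 + 2 : ℕ) : ℝ))) (poissonPair r s) := by
    have := integrable_of_bounded_sum (r := r) (s := s) (φ := fun k => 1 / ((k : ℝ) + 2)) (C := 1)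
      (inv_add_abs_le 2 (by norm_num)) 0
    simpa using this
  have h2 := (((hasIntegral_fst (r := r) (s := s)).add hasIntegral_snd).const_mul
    (-1 / ((r : ℝ) + s + 2) ^ 2)).add (hasIntegral_const
      (2 / ((r : ℝ) + s + 2) - 2 / ((r : ℝ) + s + 2) ^ 2))
  have h3 := h2.mono ⟨h1, rfl⟩ (fun z => by
    have hN : (0 : ℝ) < (z.1 : ℝ) + z.2 + 2 := by positivity
    push_cast
    rw [← sub_nonneg]
    have : 1 / ((z.1 : ℝ) + z.2 + 2) - (-1 / ((r : ℝ) + s + 2) ^ 2 * ((z.1 : ℝ) + z.2) +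
        (2 / ((r : ℝ) + s + 2) - 2 / ((r : ℝ) + s + 2) ^ 2)) =
        ((z.1 : ℝ) + z.2 + 2 - (r + s + 2)) ^ 2 /
          (((z.1 : ℝ) + z.2 + 2) * ((r : ℝ) + s + 2) ^ 2) := by
      field_simp
      ring
    rw [this]
    positivity)
  refine le_trans (le_of_eq ?_) h3
  field_simp
  ring

/-- Here `L = r + s`, `d = a r - b s`, `v = a² r + b² s`, `I = E[1/(N+2)]` and `J_k = E[1/(N+k)²]`,
with `N = X + Y`. The quartic term nearly cancels against the squared mean, and `v = abL + (a - b)d`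
separates the null variance from a part controlled by `d²`. -/
lemma variance_algebra {a b L d v J₂ J₃ J₄ I : ℝ} (ha : 0 ≤ a) (hb : 0 ≤ b) (hL : 0 ≤ L)
    (hd : d ^ 2 ≤ (a + b) ^ 2 * L ^ 2) (hv : v ≤ (a + b) ^ 2 * L)
    (hvd : v = a * b * L + (a - b) * d) (hJ₂ : L ^ 2 * J₂ ≤ 1) (hJ₂' : J₂ ≤ 1 / 4) (hJ₂0 : 0 ≤ J₂)
    (hJ₃ : L ^ 2 * J₃ ≤ 1) (hJ₃' : J₃ ≤ 1 / 4) (hJ₃0 : 0 ≤ J₃)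
    (hJ₄ : L ^ 2 * J₄ ≤ 1) (hI : 1 / (L + 2) ≤ I) :
    d ^ 4 * J₄ + 4 * v * d ^ 2 * J₃ + 2 * v ^ 2 * J₂ - (d ^ 2 * I) ^ 2 ≤
      4 * (a * b) ^ 2 * L + 16 * (a + b) ^ 2 * (d ^ 2 / (L + 2)) := by
  have hL2 : 0 < L + 2 := by linarith
  set x := 1 / (L + 2) with hx
  have hx0 : 0 < x := by positivity
  have hxL : x * (L + 2) = 1 := by rw [hx]; field_simp
  -- Multiplying the two bounds on `J` gives `(LJ)² ≤ 1/4`.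
  have half : ∀ J, 0 ≤ J → L ^ 2 * J ≤ 1 → J ≤ 1 / 4 → L * J ≤ 1 / 2 := by
    intro J h0 h1 h2
    have : (L * J) ^ 2 ≤ (1 / 2) ^ 2 := by nlinarith
    exact abs_le_of_sq_le_sq' this (by norm_num) |>.2
  have k3 : L * J₃ ≤ 2 * x := by
    rw [hx, mul_one_div, le_div_iff₀ hL2]
    nlinarith [half J₃ hJ₃0 hJ₃ hJ₃']
  have k2 : J₂ ≤ x := by
    rw [hx, le_div_iff₀ hL2]
    nlinarith [half J₂ hJ₂0 hJ₂ hJ₂']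
  have k2' : L ^ 2 * J₂ ≤ L := by
    rcases le_total 1 L with h | h
    · linarith
    · nlinarith [mul_nonneg hL hJ₂0]
  have t1 : d ^ 4 * J₄ - (d ^ 2 * I) ^ 2 ≤ d ^ 2 * ((a + b) ^ 2 * (4 * x)) := by
    have hI2 : x ^ 2 ≤ I ^ 2 := by gcongr
    have e1 : d ^ 2 * (J₄ - x ^ 2) ≤ (a + b) ^ 2 * (4 * x) := by
      rcases le_total (J₄ - x ^ 2) 0 with h | h
      · have : d ^ 2 * (J₄ - x ^ 2) ≤ 0 := mul_nonpos_of_nonneg_of_nonpos (sq_nonneg d) h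
        have : 0 ≤ (a + b) ^ 2 * (4 * x) := by positivity
        linarith
      · have h2 : L ^ 2 * (J₄ - x ^ 2) ≤ 4 * x := by
          -- Since `Lx = 1 - 2x`, the left side equals `4x - 4x²`: this is the near-cancellation.
          have : 1 - L ^ 2 * x ^ 2 ≤ 4 * x := by
            have e : L * x = 1 - 2 * x := by linarith
            have : L ^ 2 * x ^ 2 = (1 - 2 * x) ^ 2 := by rw [← e]; ring
            nlinarith
          linarith
        calc d ^ 2 * (J₄ - x ^ 2) ≤ (a + b) ^ 2 * L ^ 2 * (J₄ - x ^ 2) := by gcongr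
          _ = (a + b) ^ 2 * (L ^ 2 * (J₄ - x ^ 2)) := by ring
          _ ≤ _ := by gcongr
    have e2 := mul_le_mul_of_nonneg_left e1 (sq_nonneg d)
    have e3 := mul_le_mul_of_nonneg_left hI2 (sq_nonneg (d ^ 2))
    nlinarith
  have t2 : 4 * v * d ^ 2 * J₃ ≤ 4 * d ^ 2 * ((a + b) ^ 2 * (2 * x)) := by
    calc 4 * v * d ^ 2 * J₃ = 4 * d ^ 2 * (v * J₃) := by ring
      _ ≤ 4 * d ^ 2 * ((a + b) ^ 2 * L * J₃) := by gcongr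
      _ = 4 * d ^ 2 * ((a + b) ^ 2 * (L * J₃)) := by ring
      _ ≤ _ := by gcongr
  have t3 : 2 * v ^ 2 * J₂ ≤ 4 * (a * b) ^ 2 * L + 4 * (a + b) ^ 2 * d ^ 2 * x := by
    have hv2 : v ^ 2 ≤ 2 * (a * b) ^ 2 * L ^ 2 + 2 * (a + b) ^ 2 * d ^ 2 := by
      have h1 : (a - b) ^ 2 ≤ (a + b) ^ 2 := by nlinarith [mul_nonneg ha hb]
      have h2 := mul_le_mul_of_nonneg_right h1 (sq_nonneg d)
      have h3 := sq_nonneg (a * b * L - (a - b) * d)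
      rw [hvd]
      nlinarith
    calc 2 * v ^ 2 * J₂ ≤ 2 * (2 * (a * b) ^ 2 * L ^ 2 + 2 * (a + b) ^ 2 * d ^ 2) * J₂ := by gcongr
      _ = 4 * (a * b) ^ 2 * (L ^ 2 * J₂) + 4 * (a + b) ^ 2 * d ^ 2 * J₂ := by ring
      _ ≤ _ := by gcongr
  have : d ^ 2 / (L + 2) = d ^ 2 * x := by rw [hx]; ring
  rw [this]
  nlinarith

/-- The normalized statistic of a single element. -/
noncomputable def ratioStat (a b : ℝ) (z : ℕ × ℕ) : ℝ := quadStat a b z / ((z.1 : ℝ) + z.2)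

lemma ratioStat_eq (a b : ℝ) (z : ℕ × ℕ) :
    ratioStat a b z = quadStat a b z * (1 / ((z.1 + z.2 : ℕ) : ℝ)) := by
  rw [ratioStat]; push_cast; ring

/-- The mean of the normalized statistic, and a bound for its variance. -/
lemma ratioStat_moments {a b : ℝ} (ha : 0 ≤ a) (hb : 0 ≤ b) :
    ∃ e w : ℝ, HasIntegral (poissonPair r s) (ratioStat a b) e ∧
      HasIntegral (poissonPair r s) (fun z => ratioStat a b z ^ 2) w ∧
      (a * r = b * s → e = 0) ∧
      (a * r - b * s) ^ 2 / ((r : ℝ) + s + 2) ≤ e ∧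
      w - e ^ 2 ≤ 4 * (a * b) ^ 2 * ((r : ℝ) + s) +
        16 * (a + b) ^ 2 * ((a * r - b * s) ^ 2 / ((r : ℝ) + s + 2)) := by
  have hφ : ∀ k : ℕ, |1 / (k : ℝ)| ≤ 1 := by
    intro k
    rcases Nat.eq_zero_or_pos k with rfl | hk
    · simp
    · rw [abs_of_nonneg (by positivity), div_le_one (by positivity)]
      exact_mod_cast hk
  have hφ2 : ∀ k : ℕ, |(1 / (k : ℝ)) ^ 2| ≤ 1 := by
    intro k
    rw [abs_pow]
    exact pow_le_one₀ (abs_nonneg _) (hφ k)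
  have H1 := integral_quadStat (r := r) (s := s) hφ a b
  have H2 := integral_quadStat_sq (r := r) (s := s) hφ2 a b
  set L : ℝ := (r : ℝ) + s with hLdef
  have hr : (0 : ℝ) ≤ r := r.2
  have hs : (0 : ℝ) ≤ s := s.2
  have hL : 0 ≤ L := by positivity
  have hI := inv_le_integral_inv (r := r) (s := s)
  have hM := integral_inv_mul_le (r := r) (s := s)
  have iM : Integrable (fun z : ℕ × ℕ => 1 / ((((z.1 + z.2 : ℕ) : ℝ) + 1) *
      (((z.1 + z.2 : ℕ) : ℝ) + 2))) (poissonPair r s) := by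
    have := integrable_of_bounded_sum (r := r) (s := s)
      (φ := fun k => 1 / (((k : ℝ) + 1) * ((k : ℝ) + 2))) (C := 1) (fun k => by
        rw [abs_of_nonneg (by positivity), div_le_one (by positivity)]
        have : (0 : ℝ) ≤ k := Nat.cast_nonneg k
        nlinarith) 0
    simpa using this
  have iJ : ∀ c, Integrable (fun z : ℕ × ℕ => (1 / ((z.1 + z.2 + c : ℕ) : ℝ)) ^ 2)
      (poissonPair r s) := fun c => integrable_of_bounded_sum hφ2 c
  -- For `c ≥ 2`, `(N + c)²` dominates both `(N + 1)(N + 2)` and `4`.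
  have bJ : ∀ c : ℕ, 2 ≤ c → L ^ 2 * ∫ z, (1 / ((z.1 + z.2 + c : ℕ) : ℝ)) ^ 2 ∂poissonPair r s ≤ 1 ∧
      ∫ z, (1 / ((z.1 + z.2 + c : ℕ) : ℝ)) ^ 2 ∂poissonPair r s ≤ 1 / 4 ∧
      0 ≤ ∫ z, (1 / ((z.1 + z.2 + c : ℕ) : ℝ)) ^ 2 ∂poissonPair r s := by
    intro c hc
    have hc' : (2 : ℝ) ≤ c := by exact_mod_cast hc
    refine ⟨le_trans (mul_le_mul_of_nonneg_left ?_ (sq_nonneg L)) hM, ?_,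
      integral_nonneg fun z => by positivity⟩
    · refine integral_mono (iJ c) iM fun z => ?_
      simp only [one_div, inv_pow]
      have : (0 : ℝ) ≤ ((z.1 + z.2 : ℕ) : ℝ) := Nat.cast_nonneg _
      rw [Nat.cast_add (z.1 + z.2) c]
      gcongr
      nlinarith
    · refine HasIntegral.mono ⟨iJ c, rfl⟩ (hasIntegral_const (1 / 4)) fun z => ?_
      have : (0 : ℝ) ≤ ((z.1 + z.2 : ℕ) : ℝ) := Nat.cast_nonneg _
      rw [Nat.cast_add (z.1 + z.2) c, div_pow, one_pow]
      apply one_div_le_one_div_of_le (by norm_num)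
      nlinarith
  refine ⟨_, _, H1.congr (ratioStat_eq a b) rfl,
    H2.congr (fun z => by rw [ratioStat_eq]; ring) rfl, ?_, ?_, ?_⟩
  · intro h; rw [h]; simp
  · rw [div_eq_mul_one_div]
    exact mul_le_mul_of_nonneg_left hI (sq_nonneg _)
  · refine variance_algebra ha hb hL ?_ ?_ ?_ (bJ 2 le_rfl).1 (bJ 2 le_rfl).2.1 (bJ 2 le_rfl).2.2
      (bJ 3 (by norm_num)).1 (bJ 3 (by norm_num)).2.1 (bJ 3 (by norm_num)).2.2
      (bJ 4 (by norm_num)).1 hI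
    · rw [← mul_pow, sq_le_sq]
      rw [abs_of_nonneg (by positivity : 0 ≤ (a + b) * L), abs_le, hLdef]
      have := mul_nonneg ha hr
      have := mul_nonneg ha hs
      have := mul_nonneg hb hr
      have := mul_nonneg hb hs
      constructor <;> nlinarith
    · rw [hLdef]
      have := mul_nonneg (mul_nonneg ha hb) hr
      have := mul_nonneg (mul_nonneg ha hb) hs
      have := mul_nonneg (sq_nonneg a) hs
      have := mul_nonneg (sq_nonneg b) hr
      nlinarith
    · rw [hLdef]; ring

/-- The moments of the unnormalized statistic. -/
lemma quadStat_moments (a b : ℝ) :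
    HasIntegral (poissonPair r s) (quadStat a b) ((a * r - b * s) ^ 2) ∧
    HasIntegral (poissonPair r s) (fun z => quadStat a b z ^ 2) ((a * r - b * s) ^ 4 +
      4 * (a ^ 2 * r + b ^ 2 * s) * (a * r - b * s) ^ 2 + 2 * (a ^ 2 * r + b ^ 2 * s) ^ 2) := by
  refine ⟨(integral_quadStat (φ := fun _ => 1) (C := 1) (by simp) a b).congr (fun z => by simp)
    (by simp), (integral_quadStat_sq (φ := fun _ => 1) (C := 1) (by simp) a b).congr
    (fun z => by simp) (by simp)⟩

end InverseMoments

/-! ### Markov and Chebyshev inequalities on product spaces. -/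

section Chebyshev

variable {ι : Type*} [Fintype ι] {Ω : ι → Type*} [∀ i, MeasurableSpace (Ω i)]
  {Q : ∀ i, Measure (Ω i)} [∀ i, IsProbabilityMeasure (Q i)]

lemma HasIntegral.eval {i : ι} {f : Ω i → ℝ} {e : ℝ} (h : HasIntegral (Q i) f e) :
    HasIntegral (Measure.pi Q) (fun z => f (z i)) e := by
  have hm := measurePreserving_eval Q i
  refine ⟨hm.integrable_comp_of_integrable h.1, ?_⟩
  have hf : AEStronglyMeasurable f ((Measure.pi Q).map (Function.eval i)) := by
    rw [hm.map_eq]; exact h.1.aestronglyMeasurable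
  rw [← h.2, ← integral_map hm.measurable.aemeasurable hf, hm.map_eq]

lemma HasIntegral.sum {Ω κ : Type*} [MeasurableSpace Ω] {P : Measure Ω} {f : κ → Ω → ℝ}
    {e : κ → ℝ} (S : Finset κ) (h : ∀ i, HasIntegral P (f i) (e i)) :
    HasIntegral P (fun z => ∑ i ∈ S, f i z) (∑ i ∈ S, e i) :=
  ⟨integrable_finsetSum _ fun i _ => (h i).1, by
    rw [integral_finsetSum _ fun i _ => (h i).1]; exact Finset.sum_congr rfl fun i _ => (h i).2⟩

/-- Markov's inequality. -/
lemma HasIntegral.markov {Ω : Type*} [MeasurableSpace Ω] {P : Measure Ω} [IsProbabilityMeasure P]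
    {f : Ω → ℝ} {e t : ℝ} (h : HasIntegral P f e) (h0 : ∀ z, 0 ≤ f z) (ht : 0 < t) :
    P.real {z | t ≤ f z} ≤ e / t := by
  rw [le_div_iff₀ ht, mul_comm, ← h.2]
  exact mul_meas_ge_le_integral_of_nonneg (.of_forall h0) h.1 t

/-- Chebyshev's inequality for a sum of independent random variables. -/
lemma chebyshev_pi {f : ∀ i, Ω i → ℝ} {e w : ι → ℝ} (S : Finset ι)
    (he : ∀ i, HasIntegral (Q i) (f i) (e i))
    (hw : ∀ i, HasIntegral (Q i) (fun z => f i z ^ 2) (w i)) {t : ℝ} (ht : 0 < t) :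
    (Measure.pi Q).real {z | t ≤ |∑ i ∈ S, f i (z i) - ∑ i ∈ S, e i|} ≤
      (∑ i ∈ S, (w i - e i ^ 2)) / t ^ 2 := by
  classical
  -- Setting the terms outside `S` to zero allows the variance formula over the full index set.
  set g : ∀ i, Ω i → ℝ := fun i => if i ∈ S then f i else 0 with hg
  have hL : ∀ i, MemLp (f i) 2 (Q i) := fun i =>
    (memLp_two_iff_integrable_sq (he i).1.aestronglyMeasurable).2 (hw i).1
  have hgL : ∀ i, MemLp (g i) 2 (Q i) := by
    intro i
    by_cases hi : i ∈ S
    · simpa [hg, hi] using hL i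
    · simp [hg, hi]
  have hsum : ∀ z : ∀ i, Ω i, (∑ i, fun z : (∀ i, Ω i) => g i (z i)) z = ∑ i ∈ S, f i (z i) := by
    intro z
    rw [Finset.sum_apply, ← Finset.sum_filter_add_sum_filter_not Finset.univ (· ∈ S),
      Finset.sum_eq_zero (s := Finset.univ.filter (· ∉ S)), add_zero]
    · rw [Finset.filter_mem_eq_inter, Finset.univ_inter]
      exact Finset.sum_congr rfl fun i hi => by simp [hg, hi]
    · intro i hi
      simp [hg, (Finset.mem_filter.1 hi).2]
  have hvar : Var[∑ i, fun z : (∀ i, Ω i) => g i (z i); Measure.pi Q] =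
      ∑ i ∈ S, (w i - e i ^ 2) := by
    rw [variance_sum_pi hgL, ← Finset.sum_filter_add_sum_filter_not Finset.univ (· ∈ S),
      Finset.sum_eq_zero (s := Finset.univ.filter (· ∉ S)), add_zero]
    · rw [Finset.filter_mem_eq_inter, Finset.univ_inter]
      refine Finset.sum_congr rfl fun i hi => ?_
      have : g i = f i := by simp [hg, hi]
      rw [this, variance_eq_sub (hL i), (he i).2, ← (hw i).2]
      rfl
    · intro i hi
      have : g i = 0 := by simp [hg, (Finset.mem_filter.1 hi).2]
      rw [this, variance_zero]
  have hmem : MemLp (∑ i, fun z : (∀ i, Ω i) => g i (z i)) 2 (Measure.pi Q) :=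
    memLp_finsetSum' _ fun i _ => (hgL i).comp_measurePreserving (measurePreserving_eval Q i)
  have hE : ∫ z, (∑ i, fun z : (∀ i, Ω i) => g i (z i)) z ∂Measure.pi Q = ∑ i ∈ S, e i := by
    simp only [hsum]
    exact (HasIntegral.sum S fun i => (he i).eval).2
  have h := meas_ge_le_variance_div_sq hmem ht
  rw [hvar, hE] at h
  simp only [hsum] at h
  have h0 : 0 ≤ (∑ i ∈ S, (w i - e i ^ 2)) / t ^ 2 := by
    rw [← hvar]; exact div_nonneg (variance_nonneg _ _) (sq_nonneg _)
  exact ENNReal.toReal_le_of_le_ofReal h0 h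

end Chebyshev

/-! ### Real-valued masses and Poisson rates. -/

section Rates

variable {n : ℕ}

/-- The Poisson rate of the number of occurrences of `i`. -/
noncomputable def rate (p : PMF (Fin n)) (m : ℝ) (i : Fin n) : ℝ≥0 :=
  m.toNNReal * (p i).toNNReal

/-- The probabilities of `p` as real numbers. -/
noncomputable def mass (p : PMF (Fin n)) (i : Fin n) : ℝ := (p i).toReal

lemma mass_nonneg (p : PMF (Fin n)) (i : Fin n) : 0 ≤ mass p i := ENNReal.toReal_nonneg

lemma sum_mass (p : PMF (Fin n)) : ∑ i, mass p i = 1 := by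
  have := p.tsum_coe
  rw [tsum_fintype] at this
  unfold mass
  rw [← ENNReal.toReal_sum (fun i _ => p.apply_ne_top i), this]; simp

lemma coe_rate (p : PMF (Fin n)) {m : ℝ} (hm : 0 ≤ m) (i : Fin n) :
    (rate p m i : ℝ) = m * mass p i := by
  rw [rate, NNReal.coe_mul, Real.coe_toNNReal _ hm]; rfl

lemma sum_mass_le (p : PMF (Fin n)) (S : Finset (Fin n)) : ∑ i ∈ S, mass p i ≤ 1 := by
  rw [← sum_mass p]
  exact Finset.sum_le_sum_of_subset_of_nonneg (Finset.subset_univ _) fun i _ _ => mass_nonneg p i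

lemma pairLaw_eq (p q : PMF (Fin n)) (A B : ℝ) :
    pairLaw p q A B = Measure.pi fun i => poissonPair (rate p A i) (rate q B i) := rfl

end Rates

/-! ### Deviation bounds for the statistics on a fixed set. -/

section Deviations

variable {n : ℕ} (p q : PMF (Fin n)) {A B : ℝ}

lemma prob_total_fst (hA : 0 < A) :
    (pairLaw p q A B).real {z | A / 2 ≤ |∑ i, ((z i).1 : ℝ) - A|} ≤ 4 / A := by
  have h1 : ∀ i, HasIntegral (poissonPair (rate p A i) (rate q B i)) (fun z => (z.1 : ℝ))
      (rate p A i) := fun i => hasIntegral_fst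
  have h2 : ∀ i, HasIntegral (poissonPair (rate p A i) (rate q B i)) (fun z => (z.1 : ℝ) ^ 2)
      ((rate p A i : ℝ) + (rate p A i : ℝ) ^ 2) := fun i =>
    ((hasIntegral_fst_sub_sq.add (hasIntegral_fst.const_mul (2 * (rate p A i : ℝ)))).add
      (hasIntegral_const (-(rate p A i : ℝ) ^ 2))).congr (fun z => by ring) (by ring)
  have h := chebyshev_pi Finset.univ h1 h2 (half_pos hA)
  have hs : ∑ i, (rate p A i : ℝ) = A := by
    simp only [coe_rate p hA.le, ← Finset.mul_sum, sum_mass, mul_one]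
  simp only [add_sub_cancel_right, hs] at h
  rw [pairLaw_eq]
  refine h.trans (le_of_eq ?_)
  field_simp
  norm_num

lemma prob_total_snd (hB : 0 < B) :
    (pairLaw p q A B).real {z | B / 2 ≤ |∑ i, ((z i).2 : ℝ) - B|} ≤ 4 / B := by
  have h1 : ∀ i, HasIntegral (poissonPair (rate p A i) (rate q B i)) (fun z => (z.2 : ℝ))
      (rate q B i) := fun i => hasIntegral_snd
  have h2 : ∀ i, HasIntegral (poissonPair (rate p A i) (rate q B i)) (fun z => (z.2 : ℝ) ^ 2)
      ((rate q B i : ℝ) + (rate q B i : ℝ) ^ 2) := fun i =>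
    ((hasIntegral_snd_sub_sq.add (hasIntegral_snd.const_mul (2 * (rate q B i : ℝ)))).add
      (hasIntegral_const (-(rate q B i : ℝ) ^ 2))).congr (fun z => by ring) (by ring)
  have h := chebyshev_pi Finset.univ h1 h2 (half_pos hB)
  have hs : ∑ i, (rate q B i : ℝ) = B := by
    simp only [coe_rate q hB.le, ← Finset.mul_sum, sum_mass, mul_one]
  simp only [add_sub_cancel_right, hs] at h
  rw [pairLaw_eq]
  refine h.trans (le_of_eq ?_)
  field_simp
  norm_num

/-- The total squared error of the empirical frequencies. -/
noncomputable def sqError (A B : ℝ) (z : Fin n → ℕ × ℕ) : ℝ :=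
  ∑ i, ((((z i).1 : ℝ) / A - mass p i) ^ 2 + (((z i).2 : ℝ) / B - mass q i) ^ 2)

lemma hasIntegral_sq_freq_fst (hA : 0 < A) (i : Fin n) :
    HasIntegral (pairLaw p q A B) (fun z => (((z i).1 : ℝ) / A - mass p i) ^ 2)
      (mass p i / A) := by
  refine HasIntegral.congr (HasIntegral.eval (Q := fun i => poissonPair (rate p A i) (rate q B i))
    ((hasIntegral_fst_sub_sq (r := rate p A i)
    (s := rate q B i)).const_mul (1 / A ^ 2))) (fun z => ?_) ?_
  · rw [coe_rate p hA.le]; field_simp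
  · rw [coe_rate p hA.le]; field_simp

lemma hasIntegral_sq_freq_snd (hB : 0 < B) (i : Fin n) :
    HasIntegral (pairLaw p q A B) (fun z => (((z i).2 : ℝ) / B - mass q i) ^ 2)
      (mass q i / B) := by
  refine HasIntegral.congr (HasIntegral.eval (Q := fun i => poissonPair (rate p A i) (rate q B i))
    ((hasIntegral_snd_sub_sq (r := rate p A i)
    (s := rate q B i)).const_mul (1 / B ^ 2))) (fun z => ?_) ?_
  · rw [coe_rate q hB.le]; field_simp
  · rw [coe_rate q hB.le]; field_simp

lemma prob_sqError (hA : 0 < A) (hB : 0 < B) {t : ℝ} (ht : 0 < t) :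
    (pairLaw p q A B).real {z | t ≤ sqError p q A B z} ≤ (1 / A + 1 / B) / t := by
  have h := HasIntegral.sum Finset.univ fun i =>
    (hasIntegral_sq_freq_fst p q (B := B) hA i).add (hasIntegral_sq_freq_snd p q (A := A) hB i)
  have e : ∑ i, (mass p i / A + mass q i / B) = 1 / A + 1 / B := by
    rw [Finset.sum_add_distrib, ← Finset.sum_div, ← Finset.sum_div, sum_mass, sum_mass]
  rw [e] at h
  exact h.markov (fun z => Finset.sum_nonneg fun i _ => by positivity) ht

/-- The total absolute error of the empirical frequencies on `S`. -/
noncomputable def absError (A B : ℝ) (S : Finset (Fin n)) (z : Fin n → ℕ × ℕ) : ℝ :=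
  ∑ i ∈ S, (|((z i).1 : ℝ) / A - mass p i| + |((z i).2 : ℝ) / B - mass q i|)

/-- Markov's inequality after `|x| ≤ x²/(2η) + η/2`. The free parameter `η` balances the size of `S`
against the total variance. -/
lemma prob_absError (hA : 0 < A) (hB : 0 < B) (S : Finset (Fin n)) {t η : ℝ} (ht : 0 < t)
    (hη : 0 < η) :
    (pairLaw p q A B).real {z | t ≤ absError p q A B S z} ≤
      (S.card * η + (1 / A + 1 / B) / (2 * η)) / t := by
  have h := HasIntegral.sum S fun i =>
    (((hasIntegral_sq_freq_fst p q (B := B) hA i).add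
      (hasIntegral_sq_freq_snd p q (A := A) hB i)).const_mul (1 / (2 * η))).add
      (⟨integrable_const η, by simp⟩ : HasIntegral (pairLaw p q A B) (fun _ => η) η)
  have h2 := h.markov (fun z => Finset.sum_nonneg fun i _ => by positivity) ht
  have key : ∀ x : ℝ, |x| ≤ 1 / (2 * η) * x ^ 2 + η / 2 := by
    intro x
    rw [← sub_nonneg]
    have : 1 / (2 * η) * x ^ 2 + η / 2 - |x| = (|x| - η) ^ 2 / (2 * η) := by
      rw [← sq_abs x]; field_simp; ring
    rw [this]; positivity
  refine (measureReal_mono fun z hz => ?_).trans (h2.trans ?_)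
  · refine (show t ≤ absError p q A B S z from hz).trans (Finset.sum_le_sum fun i _ => ?_)
    have h1 := key (((z i).1 : ℝ) / A - mass p i)
    have h3 := key (((z i).2 : ℝ) / B - mass q i)
    linarith
  · gcongr
    rw [Finset.sum_add_distrib, ← Finset.mul_sum, Finset.sum_add_distrib, ← Finset.sum_div,
      ← Finset.sum_div, Finset.sum_const, nsmul_eq_mul, add_comm]
    have := sum_mass_le p S
    have := sum_mass_le q S
    have e : (1 / A + 1 / B) / (2 * η) = 1 / (2 * η) * (1 / A + 1 / B) := by ring
    rw [e]
    gcongr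

/-- The statistic `W` on a fixed set. -/
noncomputable def quadSum (A B : ℝ) (S : Finset (Fin n)) (z : Fin n → ℕ × ℕ) : ℝ :=
  ∑ i ∈ S, quadStat B A (z i)

lemma prob_quadSum (hA : 0 < A) (hB : 0 < B) (S : Finset (Fin n)) {t L : ℝ} (ht : 0 < t)
    (hL : ∑ i ∈ S, (mass p i ^ 2 + mass q i ^ 2) ≤ L) :
    (pairLaw p q A B).real {z | t ≤ |quadSum A B S z -
        (A * B) ^ 2 * ∑ i ∈ S, (mass p i - mass q i) ^ 2|} ≤
      (2 * (A * B * (A + B) * √L) ^ 2 + 4 * (A * B * (A + B) * √L) *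
        ((A * B) ^ 2 * ∑ i ∈ S, (mass p i - mass q i) ^ 2)) / t ^ 2 := by
  have h := chebyshev_pi S
    (fun i => (quadStat_moments (r := rate p A i) (s := rate q B i) B A).1)
    (fun i => (quadStat_moments (r := rate p A i) (s := rate q B i) B A).2) ht
  have hd : ∀ i, B * (rate p A i : ℝ) - A * (rate q B i : ℝ) =
      A * B * (mass p i - mass q i) := fun i => by
    rw [coe_rate p hA.le, coe_rate q hB.le]; ring
  have hv : ∀ i, B ^ 2 * (rate p A i : ℝ) + A ^ 2 * (rate q B i : ℝ) =
      A * B * (B * mass p i + A * mass q i) := fun i => by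
    rw [coe_rate p hA.le, coe_rate q hB.le]; ring
  simp only [hd, hv, mul_pow, ← Finset.mul_sum] at h
  have h0 : ∀ i ∈ S, 0 ≤ mass p i ^ 2 + mass q i ^ 2 := fun i _ => by positivity
  have hL0 : 0 ≤ L := (Finset.sum_nonneg h0).trans hL
  have hsq : √L ^ 2 = L := Real.sq_sqrt hL0
  rw [pairLaw_eq, mul_pow]
  refine h.trans ?_
  gcongr
  -- One quantity `G` bounds both each linear variance term and the root of the sum of their
  -- squares, so the variance is at most `2G² + 4GD`, with `D` the mean.
  set G := A * B * (A + B) * √L with hG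
  have hv2 : ∀ i, (A * B * (B * mass p i + A * mass q i)) ^ 2 ≤
      (A * B * (A + B)) ^ 2 * (mass p i ^ 2 + mass q i ^ 2) := by
    intro i
    have h1 : (B * mass p i + A * mass q i) ^ 2 ≤
        (A + B) ^ 2 * (mass p i ^ 2 + mass q i ^ 2) := by
      have := sq_nonneg (A * mass p i - B * mass q i)
      have := mul_nonneg (mul_nonneg hA.le hB.le)
        (add_nonneg (sq_nonneg (mass p i)) (sq_nonneg (mass q i)))
      nlinarith
    calc (A * B * (B * mass p i + A * mass q i)) ^ 2
        = (A * B) ^ 2 * (B * mass p i + A * mass q i) ^ 2 := by ring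
      _ ≤ (A * B) ^ 2 * ((A + B) ^ 2 * (mass p i ^ 2 + mass q i ^ 2)) := by gcongr
      _ = _ := by ring
  have hvG : ∀ i ∈ S, A * B * (B * mass p i + A * mass q i) ≤ G := by
    intro i hi
    have h1 : (A * B * (B * mass p i + A * mass q i)) ^ 2 ≤ G ^ 2 := by
      rw [hG, mul_pow _ (√L), hsq]
      refine (hv2 i).trans ?_
      gcongr
      exact (Finset.single_le_sum (f := fun i => mass p i ^ 2 + mass q i ^ 2) h0 hi).trans hL
    exact (abs_le_of_sq_le_sq' h1 (by positivity)).2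
  have hG2 : ∑ i ∈ S, (A * B * (B * mass p i + A * mass q i)) ^ 2 ≤ G ^ 2 := by
    refine (Finset.sum_le_sum fun i _ => hv2 i).trans ?_
    rw [← Finset.mul_sum, hG, mul_pow _ (√L), hsq]
    gcongr
  calc ∑ i ∈ S, _ ≤ ∑ i ∈ S, (2 * (A * B * (B * mass p i + A * mass q i)) ^ 2 +
        4 * G * (A ^ 2 * B ^ 2 * (mass p i - mass q i) ^ 2)) := by
        refine Finset.sum_le_sum fun i hi => ?_
        have := mul_le_mul_of_nonneg_right (hvG i hi)
          (by positivity : 0 ≤ 4 * (A ^ 2 * B ^ 2 * (mass p i - mass q i) ^ 2))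
        linarith
    _ = 2 * ∑ i ∈ S, (A * B * (B * mass p i + A * mass q i)) ^ 2 +
        4 * G * (A ^ 2 * B ^ 2 * ∑ i ∈ S, (mass p i - mass q i) ^ 2) := by
        rw [Finset.sum_add_distrib, Finset.mul_sum, ← Finset.mul_sum, ← Finset.mul_sum,
          ← Finset.mul_sum]
    _ ≤ _ := by gcongr

/-- The statistic `Z` on a fixed set. -/
noncomputable def ratioSum (A B : ℝ) (S : Finset (Fin n)) (z : Fin n → ℕ × ℕ) : ℝ :=
  ∑ i ∈ S, ratioStat B A (z i)

/-- The lower bound for the mean of `Z`. -/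
noncomputable def ratioMean (A B : ℝ) (S : Finset (Fin n)) : ℝ :=
  ∑ i ∈ S, (A * B * (mass p i - mass q i)) ^ 2 / (A * mass p i + B * mass q i + 2)

/-- The exact mean `e` has no closed form; its lower bound `ratioMean` also controls the non-null
part of the variance. -/
lemma prob_ratioSum (hA : 0 < A) (hB : 0 < B) (S : Finset (Fin n)) :
    ∃ e : ℝ, (p = q → e = 0) ∧ ratioMean p q A B S ≤ e ∧ ∀ t, 0 < t →
      (pairLaw p q A B).real {z | t ≤ |ratioSum A B S z - e|} ≤
        (4 * (A * B) ^ 2 * (A + B) + 16 * (A + B) ^ 2 * ratioMean p q A B S) / t ^ 2 := by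
  choose e w he hw hz hle hvar using fun i =>
    ratioStat_moments (r := rate p A i) (s := rate q B i) hB.le hA.le
  have hd : ∀ i, B * (rate p A i : ℝ) - A * (rate q B i : ℝ) =
      A * B * (mass p i - mass q i) := fun i => by
    rw [coe_rate p hA.le, coe_rate q hB.le]; ring
  refine ⟨∑ i ∈ S, e i, ?_, ?_, ?_⟩
  · rintro rfl
    refine Finset.sum_eq_zero fun i _ => hz i ?_
    have := hd i
    rw [sub_self, mul_zero] at this
    linarith
  · refine Finset.sum_le_sum fun i _ => ?_
    have := hle i
    rwa [hd, coe_rate p hA.le, coe_rate q hB.le] at this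
  · intro t ht
    refine (chebyshev_pi S he hw ht).trans ?_
    gcongr
    calc ∑ i ∈ S, (w i - e i ^ 2) ≤ ∑ i ∈ S, (4 * (A * B) ^ 2 * (A * mass p i + B * mass q i) +
          16 * (A + B) ^ 2 * ((A * B * (mass p i - mass q i)) ^ 2 /
            (A * mass p i + B * mass q i + 2))) := by
          refine Finset.sum_le_sum fun i _ => ?_
          have := hvar i
          rw [hd, coe_rate p hA.le, coe_rate q hB.le] at this
          refine this.trans (le_of_eq ?_)
          ring
      _ = 4 * (A * B) ^ 2 * (A * ∑ i ∈ S, mass p i + B * ∑ i ∈ S, mass q i) +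
          16 * (A + B) ^ 2 * ratioMean p q A B S := by
          rw [Finset.sum_add_distrib, ← Finset.mul_sum, ← Finset.mul_sum, Finset.sum_add_distrib,
            ← Finset.mul_sum, ← Finset.mul_sum, ratioMean]
      _ ≤ 4 * (A * B) ^ 2 * (A * 1 + B * 1) + 16 * (A + B) ^ 2 * ratioMean p q A B S := by
          gcongr
          · exact sum_mass_le p S
          · exact sum_mass_le q S
      _ = _ := by ring

/-- Cauchy-Schwarz lower bound for the mean of `Z`. -/
lemma le_ratioMean (hA : 0 < A) (hB : 0 < B) (S : Finset (Fin n)) :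
    (A * B * ∑ i ∈ S, |mass p i - mass q i|) ^ 2 ≤ ratioMean p q A B S * (A + B + 2 * n) := by
  have hpos : ∀ i ∈ S, 0 < A * mass p i + B * mass q i + 2 := fun i _ => by
    have := mass_nonneg p i; have := mass_nonneg q i; positivity
  have h := Finset.sq_sum_div_le_sum_sq_div S (fun i => A * B * |mass p i - mass q i|) hpos
  simp only [mul_pow _ |_|, sq_abs] at h
  have e : ∑ i ∈ S, (A * B) ^ 2 * (mass p i - mass q i) ^ 2 /
      (A * mass p i + B * mass q i + 2) = ratioMean p q A B S := by
    simp only [ratioMean, mul_pow _ (_ - _)]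
  rw [e, ← Finset.mul_sum] at h
  have hR : 0 ≤ ratioMean p q A B S := Finset.sum_nonneg fun i hi => by
    have := hpos i hi; positivity
  have hs : ∑ i ∈ S, (A * mass p i + B * mass q i + 2) ≤ A + B + 2 * n := by
    rw [Finset.sum_add_distrib, Finset.sum_add_distrib, ← Finset.mul_sum, ← Finset.mul_sum,
      Finset.sum_const, nsmul_eq_mul]
    have h1 := mul_le_mul_of_nonneg_left (sum_mass_le p S) hA.le
    have h2 := mul_le_mul_of_nonneg_left (sum_mass_le q S) hB.le
    have h3 : (S.card : ℝ) ≤ n := by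
      exact_mod_cast (Finset.card_le_univ S).trans (by simp)
    linarith
  rcases S.eq_empty_or_nonempty with rfl | hne
  · simp [ratioMean]
  · have hp := Finset.sum_pos hpos hne
    rw [div_le_iff₀ hp] at h
    exact h.trans (by gcongr)

end Deviations

/-! ### Analysis of the three checks under the parameter inequalities. -/

section Test

variable {n : ℕ}

open Classical in
/-- The heavy set, as a function of the counts in the first batches. -/
noncomputable def heavy (ε A B : ℝ) (u : Fin n → ℕ × ℕ) : Finset (Fin n) :=
  Finset.univ.filter (fun i => ((u i).1 : ℝ) / A > thrB n ε B) ∪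
    Finset.univ.filter (fun i => ((u i).2 : ℝ) / B > thrB n ε B)

open Classical in
/-- The medium set, as a function of the counts in the first batches. -/
noncomputable def medium (ε A B : ℝ) (u : Fin n → ℕ × ℕ) : Finset (Fin n) :=
  Finset.univ.filter fun i => thrB' n B ≤ max (((u i).1 : ℝ) / A) (((u i).2 : ℝ) / B) ∧
    max (((u i).1 : ℝ) / A) (((u i).2 : ℝ) / B) ≤ thrB n ε B

open Classical in
/-- The light set, as a function of the counts in the first batches. -/
noncomputable def light (ε A B : ℝ) (u : Fin n → ℕ × ℕ) : Finset (Fin n) :=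
  Finset.univ \ (heavy ε A B u ∪ medium ε A B u)

/-- The statistic `V` on a fixed set. -/
noncomputable def absSum (A B : ℝ) (S : Finset (Fin n)) (v : Fin n → ℕ × ℕ) : ℝ :=
  ∑ i ∈ S, |((v i).1 : ℝ) / A - ((v i).2 : ℝ) / B|

/-- The quantitative relations between the parameters that hold for large `n`. -/
structure Regime (n : ℕ) (ε A B : ℝ) : Prop where
  le_A : 10 ^ 14 ≤ A
  le_B : 400 ≤ B
  ε_pos : 0 < ε
  ε_le : ε ≤ 2
  B_le : B ≤ 10 ^ 7 * A
  le_log : 10 ^ 12 ≤ Real.log n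
  quad : A * B * (A + B) * √(8 * thrB n ε B) ≤ ε ^ 2 * A ^ 2 * B * Real.log n / 2 / 1000
  A_le_n : A ≤ n
  B_le_n : B ≤ n
  rel : √A * B * ε ^ 2 = 10 ^ 7 * n

/-- The total counts are close to their means. -/
def TotalsOK (A B : ℝ) (u : Fin n → ℕ × ℕ) : Prop :=
  |∑ i, ((u i).1 : ℝ) - A| < A / 2 ∧ |∑ i, ((u i).2 : ℝ) - B| < B / 2

variable {ε A B : ℝ} {p q : PMF (Fin n)} {u v : Fin n → ℕ × ℕ}

lemma Regime.A_pos (h : Regime n ε A B) : 0 < A := by linarith [h.le_A]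

lemma Regime.B_pos (h : Regime n ε A B) : 0 < B := by linarith [h.le_B]

lemma Regime.log_pos (h : Regime n ε A B) : 0 < Real.log n := by linarith [h.le_log]

lemma Regime.thrB_pos (h : Regime n ε A B) : 0 < thrB n ε B := by
  have := h.B_pos; have := h.log_pos; have := h.ε_pos
  unfold thrB; positivity

lemma Regime.thrB'_pos (h : Regime n ε A B) : 0 < thrB' n B := by
  have := h.B_pos; have := h.log_pos
  unfold thrB'; positivity

lemma Regime.inv_A_add_inv_B_le (h : Regime n ε A B) : 1 / A + 1 / B ≤ (10 ^ 7 + 1) / B := by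
  have := h.B_pos; have := h.A_pos
  have h1 : 1 / A ≤ 10 ^ 7 / B := by
    rw [div_le_div_iff₀ h.A_pos h.B_pos]; linarith [h.B_le]
  rw [add_div]
  linarith

lemma prob_not_totalsOK (h : Regime n ε A B) :
    (pairLaw p q A B).real {u | ¬ TotalsOK A B u} ≤ 2 / 100 := by
  have h1 := prob_total_fst p q (B := B) h.A_pos
  have h2 := prob_total_snd p q (A := A) h.B_pos
  have h3 : 4 / A ≤ 1 / 100 := by
    rw [div_le_div_iff₀ h.A_pos (by norm_num)]; linarith [h.le_A]
  have h4 : 4 / B ≤ 1 / 100 := by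
    rw [div_le_div_iff₀ h.B_pos (by norm_num)]; linarith [h.le_B]
  have hsub : {u : Fin n → ℕ × ℕ | ¬ TotalsOK A B u} ⊆
      {z | A / 2 ≤ |∑ i, ((z i).1 : ℝ) - A|} ∪ {z | B / 2 ≤ |∑ i, ((z i).2 : ℝ) - B|} := by
    intro u hu
    by_contra hc
    simp only [Set.mem_union, Set.mem_ofPred_eq, not_or, not_le] at hc
    exact hu hc
  have := (measureReal_mono (μ := pairLaw p q A B) hsub).trans (measureReal_union_le _ _)
  linarith

/-- The expected squared error is `1/A + 1/B`, of order `1/B`, while `b ≥ 64 log n / B` because `ε ≤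
2`. -/
lemma prob_sqError_regime (h : Regime n ε A B) :
    (pairLaw p q A B).real {u | thrB n ε B ≤ sqError p q A B u} ≤ 1 / 100 := by
  refine (prob_sqError p q h.A_pos h.B_pos h.thrB_pos).trans ?_
  have hB := h.B_pos
  have hℓ := h.log_pos
  have hε := h.ε_pos
  rw [div_le_iff₀ h.thrB_pos]
  refine h.inv_A_add_inv_B_le.trans ?_
  unfold thrB
  rw [mul_div_assoc', div_le_div_iff₀ hB (by positivity)]
  have h4 : ε ^ 2 ≤ 4 := by nlinarith [h.ε_le]
  have := h.le_log
  nlinarith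

lemma TotalsOK.freq_sum_le (hu : TotalsOK A B u) (h : Regime n ε A B) (S : Finset (Fin n)) :
    ∑ i ∈ S, (((u i).1 : ℝ) / A + ((u i).2 : ℝ) / B) ≤ 4 := by
  have hA := h.A_pos
  have hB := h.B_pos
  refine (Finset.sum_le_sum_of_subset_of_nonneg (Finset.subset_univ S)
    fun i _ _ => by positivity).trans ?_
  rw [Finset.sum_add_distrib, ← Finset.sum_div, ← Finset.sum_div]
  have h1 := (abs_lt.1 hu.1).2
  have h2 := (abs_lt.1 hu.2).2
  have h3 : (∑ i, ((u i).1 : ℝ)) / A ≤ 2 := by rw [div_le_iff₀ hA]; linarith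
  have h4 : (∑ i, ((u i).2 : ℝ)) / B ≤ 2 := by rw [div_le_iff₀ hB]; linarith
  linarith

/-- Counting: each heavy element uses more than `b` of a total empirical mass of at most 4. -/
lemma card_heavy_mul_le (hu : TotalsOK A B u) (h : Regime n ε A B) :
    ((heavy ε A B u).card : ℝ) * thrB n ε B ≤ 4 := by
  have hA := h.A_pos
  have hB := h.B_pos
  rw [← nsmul_eq_mul]
  refine (Finset.card_nsmul_le_sum _ (fun i => ((u i).1 : ℝ) / A + ((u i).2 : ℝ) / B) _
    fun i hi => ?_).trans (hu.freq_sum_le h _)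
  have h1 : 0 ≤ ((u i).1 : ℝ) / A := by positivity
  have h2 : 0 ≤ ((u i).2 : ℝ) / B := by positivity
  simp only [heavy, Finset.mem_union, Finset.mem_filter, Finset.mem_univ, true_and] at hi
  rcases hi with hi | hi <;> linarith

lemma card_medium_mul_le (hu : TotalsOK A B u) (h : Regime n ε A B) :
    ((medium ε A B u).card : ℝ) * thrB' n B ≤ 4 := by
  have hA := h.A_pos
  have hB := h.B_pos
  rw [← nsmul_eq_mul]
  refine (Finset.card_nsmul_le_sum _ (fun i => ((u i).1 : ℝ) / A + ((u i).2 : ℝ) / B) _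
    fun i hi => ?_).trans (hu.freq_sum_le h _)
  have h1 : 0 ≤ ((u i).1 : ℝ) / A := by positivity
  have h2 : 0 ≤ ((u i).2 : ℝ) / B := by positivity
  simp only [medium, Finset.mem_filter, Finset.mem_univ, true_and] at hi
  exact hi.1.trans (max_le (by linarith) (by linarith))

lemma sum_medium_sq_le (h : Regime n ε A B) (hu : sqError p q A B u < thrB n ε B) :
    ∑ i ∈ medium ε A B u, (mass p i ^ 2 + mass q i ^ 2) ≤ 8 * thrB n ε B := by
  set b := thrB n ε B with hb
  have hb0 : 0 < b := h.thrB_pos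
  -- Either `P ≤ 2b`, or the empirical frequency misses `P` by at least `P/2`, and the squared error
  -- pays for `P²`.
  have key : ∀ x P : ℝ, x ≤ b → 0 ≤ P → P ^ 2 ≤ 2 * b * P + 4 * (x - P) ^ 2 := by
    intro x P hx hP
    rcases le_total P (2 * b) with h1 | h1
    · nlinarith [sq_nonneg (x - P)]
    · have : P / 2 ≤ P - x := by linarith
      have : (P / 2) ^ 2 ≤ (P - x) ^ 2 := by gcongr
      nlinarith [mul_nonneg hb0.le hP]
  calc ∑ i ∈ medium ε A B u, (mass p i ^ 2 + mass q i ^ 2)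
      ≤ ∑ i ∈ medium ε A B u, (2 * b * mass p i + 2 * b * mass q i +
          4 * ((((u i).1 : ℝ) / A - mass p i) ^ 2 + (((u i).2 : ℝ) / B - mass q i) ^ 2)) := by
        refine Finset.sum_le_sum fun i hi => ?_
        simp only [medium, Finset.mem_filter, Finset.mem_univ, true_and] at hi
        have h1 := key _ _ ((le_max_left _ _).trans hi.2) (mass_nonneg p i)
        have h2 := key _ _ ((le_max_right _ _).trans hi.2) (mass_nonneg q i)
        linarith
    _ = 2 * b * ∑ i ∈ medium ε A B u, mass p i + 2 * b * ∑ i ∈ medium ε A B u, mass q i +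
          4 * ∑ i ∈ medium ε A B u,
            ((((u i).1 : ℝ) / A - mass p i) ^ 2 + (((u i).2 : ℝ) / B - mass q i) ^ 2) := by
        rw [Finset.sum_add_distrib, Finset.sum_add_distrib, Finset.mul_sum, Finset.mul_sum,
          Finset.mul_sum]
    _ ≤ 2 * b * 1 + 2 * b * 1 + 4 * sqError p q A B u := by
        gcongr
        · exact sum_mass_le p _
        · exact sum_mass_le q _
        · exact Finset.sum_le_sum_of_subset_of_nonneg (Finset.subset_univ _)
            fun i _ _ => by positivity
    _ ≤ 8 * b := by linarith

lemma prob_absError_regime (h : Regime n ε A B) {S : Finset (Fin n)}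
    (hS : (S.card : ℝ) * thrB n ε B ≤ 4) :
    (pairLaw p q A B).real {v | ε / 12 ≤ absError p q A B S v} ≤ 2 / 100 := by
  have hε := h.ε_pos
  have hb := h.thrB_pos
  have hB := h.B_pos
  have hℓ := h.log_pos
  -- This `η` makes the cardinality term and the variance term each at most `ε/2400`, the latter
  -- thanks to `log n ≥ 10^12`; together they are one percent of `ε/12`.
  have hη : 0 < thrB n ε B * ε / 9600 := by positivity
  refine (prob_absError p q h.A_pos h.B_pos S (t := ε / 12) (by positivity) hη).trans ?_
  rw [div_le_iff₀ (by positivity)]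
  have h1 : (S.card : ℝ) * (thrB n ε B * ε / 9600) ≤ ε / 2400 := by
    have := mul_le_mul_of_nonneg_right hS hε.le
    linarith
  have h2 : (1 / A + 1 / B) / (2 * (thrB n ε B * ε / 9600)) ≤ ε / 2400 := by
    rw [div_le_iff₀ (by positivity)]
    refine h.inv_A_add_inv_B_le.trans ?_
    have e : ε / 2400 * (2 * (thrB n ε B * ε / 9600)) = 256 * Real.log n / (11520000 * B) := by
      unfold thrB; field_simp; norm_num
    rw [e, div_le_div_iff₀ hB (by positivity)]
    have := h.le_log
    nlinarith
  linarith

lemma absSum_le (S : Finset (Fin n)) (v : Fin n → ℕ × ℕ) :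
    absSum A B S v ≤ ∑ i ∈ S, |mass p i - mass q i| + absError p q A B S v := by
  rw [absSum, absError, ← Finset.sum_add_distrib]
  refine Finset.sum_le_sum fun i _ => ?_
  have h1 := abs_sub_le (((v i).1 : ℝ) / A) (mass p i) (((v i).2 : ℝ) / B)
  have h2 := abs_sub_le (mass p i) (mass q i) (((v i).2 : ℝ) / B)
  rw [abs_sub_comm (mass q i)] at h2
  linarith

lemma le_absSum (S : Finset (Fin n)) (v : Fin n → ℕ × ℕ) :
    ∑ i ∈ S, |mass p i - mass q i| - absError p q A B S v ≤ absSum A B S v := by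
  rw [absSum, absError, ← Finset.sum_sub_distrib]
  refine Finset.sum_le_sum fun i _ => ?_
  have h1 := abs_sub_le (mass p i) (((v i).1 : ℝ) / A) (mass q i)
  have h2 := abs_sub_le (((v i).1 : ℝ) / A) (((v i).2 : ℝ) / B) (mass q i)
  rw [abs_sub_comm (mass p i) (((v i).1 : ℝ) / A)] at h1
  linarith

lemma prob_quadSum_null (h : Regime n ε A B) {S : Finset (Fin n)}
    (hS : ∑ i ∈ S, (mass p i ^ 2 + mass p i ^ 2) ≤ 8 * thrB n ε B) :
    (pairLaw p p A B).real {v | ¬ quadSum A B S v ≤ ε ^ 2 * A ^ 2 * B * Real.log n / 2} ≤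
      1 / 100 := by
  set τ := ε ^ 2 * A ^ 2 * B * Real.log n / 2 with hτ
  have hτ0 : 0 < τ := by
    have := h.ε_pos; have := h.A_pos; have := h.B_pos; have := h.log_pos; positivity
  have hG0 : 0 ≤ A * B * (A + B) * √(8 * thrB n ε B) := by
    have := h.A_pos; have := h.B_pos; positivity
  have hq := h.quad
  have h1 := prob_quadSum p p h.A_pos h.B_pos S hτ0 hS
  simp only [sub_self, ne_eq, OfNat.ofNat_ne_zero, not_false_eq_true, zero_pow,
    Finset.sum_const_zero, mul_zero, sub_zero, add_zero] at h1
  refine (measureReal_mono fun v hv => ?_).trans (h1.trans ?_)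
  · exact (not_le.1 hv).le.trans (le_abs_self _)
  · rw [div_le_iff₀ (by positivity)]
    have : (A * B * (A + B) * √(8 * thrB n ε B)) ^ 2 ≤ (τ / 1000) ^ 2 := by gcongr
    nlinarith

lemma prob_quadSum_far (h : Regime n ε A B) {S : Finset (Fin n)}
    (hS : ∑ i ∈ S, (mass p i ^ 2 + mass q i ^ 2) ≤ 8 * thrB n ε B)
    (hcard : (S.card : ℝ) * thrB' n B ≤ 4) (hfar : ε / 3 ≤ ∑ i ∈ S, |mass p i - mass q i|) :
    (pairLaw p q A B).real {v | quadSum A B S v ≤ ε ^ 2 * A ^ 2 * B * Real.log n / 2} ≤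
      2 / 100 := by
  have hε := h.ε_pos
  have hA := h.A_pos
  have hB := h.B_pos
  have hℓ := h.log_pos
  set τ := ε ^ 2 * A ^ 2 * B * Real.log n / 2 with hτ
  have hτ0 : 0 < τ := by positivity
  set D := (A * B) ^ 2 * ∑ i ∈ S, (mass p i - mass q i) ^ 2 with hD
  set G := A * B * (A + B) * √(8 * thrB n ε B) with hG
  have hG0 : 0 ≤ G := by positivity
  have hq : G ≤ τ / 1000 := h.quad
  -- Cauchy-Schwarz on at most `4/b'` elements puts the mean at least twice above the threshold, so
  -- acceptance requires a deviation of at least `D/2`.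
  have hDτ : 2 * τ ≤ D := by
    have h1 := sq_sum_le_card_mul_sum_sq (s := S) (f := fun i => |mass p i - mass q i|)
    simp only [sq_abs] at h1
    have h2 : (ε / 3) ^ 2 ≤ (∑ i ∈ S, |mass p i - mass q i|) ^ 2 := by gcongr
    set s := ∑ i ∈ S, (mass p i - mass q i) ^ 2 with hs
    have hs0 : 0 ≤ s := Finset.sum_nonneg fun i _ => sq_nonneg _
    have h3 : (ε / 3) ^ 2 * thrB' n B ≤ 4 * s := by
      calc (ε / 3) ^ 2 * thrB' n B ≤ (S.card * s) * thrB' n B :=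
            mul_le_mul_of_nonneg_right (h2.trans h1) h.thrB'_pos.le
        _ = (S.card * thrB' n B) * s := by ring
        _ ≤ _ := by gcongr
    have h4 : ε ^ 2 * (256 * Real.log n) ≤ 36 * s * B := by
      have e : (ε / 3) ^ 2 * thrB' n B = ε ^ 2 * (256 * Real.log n) / (9 * B) := by
        unfold thrB'; field_simp; norm_num
      rw [e, div_le_iff₀ (by positivity)] at h3
      linarith
    have h5 := mul_le_mul_of_nonneg_left h4 (by positivity : 0 ≤ A ^ 2 * B)
    have h6 : 0 < ε ^ 2 * A ^ 2 * B * Real.log n := by positivity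
    rw [hτ, hD]
    nlinarith
  have hD0 : 0 < D := by linarith
  have h1 := prob_quadSum p q hA hB S (half_pos hD0) hS
  refine (measureReal_mono fun v hv => ?_).trans (h1.trans ?_)
  · have : quadSum A B S v ≤ τ := hv
    refine le_trans ?_ (neg_le_abs (_ : ℝ))
    linarith
  · rw [div_le_iff₀ (by positivity)]
    have hGD : G ≤ D / 2000 := by linarith
    have : G ^ 2 ≤ (D / 2000) ^ 2 := by gcongr
    have := mul_le_mul_of_nonneg_right hGD hD0.le
    nlinarith

lemma rpow_three_halves (hA : 0 < A) : A ^ (3 / 2 : ℝ) = A * √A := by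
  rw [show (3 / 2 : ℝ) = 1 + 1 / 2 by norm_num, Real.rpow_add hA, Real.rpow_one,
    Real.sqrt_eq_rpow]

lemma prob_ratioSum_null (h : Regime n ε A B) (S : Finset (Fin n)) :
    (pairLaw p p A B).real {v | ¬ ratioSum A B S v ≤ 10 ^ 5 * A ^ (3 / 2 : ℝ) * B} ≤
      1 / 100 := by
  have hA := h.A_pos
  have hB := h.B_pos
  rw [rpow_three_halves hA]
  set τ := 10 ^ 5 * (A * √A) * B with hτ
  have hτ0 : 0 < τ := by positivity
  obtain ⟨e, he0, -, hdev⟩ := prob_ratioSum p p hA hB S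
  have h1 := hdev τ hτ0
  rw [he0 rfl] at h1
  have hR : ratioMean p p A B S = 0 := by simp [ratioMean]
  rw [hR, mul_zero, add_zero] at h1
  refine (measureReal_mono fun v hv => ?_).trans (h1.trans ?_)
  · have := (not_le.1 hv).le
    simpa using this.trans (le_abs_self _)
  · rw [div_le_iff₀ (by positivity)]
    have e : τ ^ 2 = 10 ^ 10 * (A * B) ^ 2 * A := by
      rw [hτ, mul_pow, mul_pow, mul_pow, Real.sq_sqrt hA.le]; ring
    rw [e]
    have := mul_le_mul_of_nonneg_left h.B_le (by positivity : 0 ≤ (A * B) ^ 2)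
    have : 0 < (A * B) ^ 2 * A := by positivity
    nlinarith

lemma prob_ratioSum_far (h : Regime n ε A B) {S : Finset (Fin n)}
    (hfar : ε / 3 ≤ ∑ i ∈ S, |mass p i - mass q i|) :
    (pairLaw p q A B).real {v | ratioSum A B S v ≤ 10 ^ 5 * A ^ (3 / 2 : ℝ) * B} ≤
      2 / 100 := by
  have hε := h.ε_pos
  have hA := h.A_pos
  have hB := h.B_pos
  have hsA : 0 < √A := Real.sqrt_pos.2 hA
  have hsq : √A ^ 2 = A := Real.sq_sqrt hA.le
  have hn : (0 : ℝ) < n := hA.trans_le h.A_le_n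
  rw [rpow_three_halves hA]
  set τ := 10 ^ 5 * (A * √A) * B with hτ
  have hτ0 : 0 < τ := by positivity
  obtain ⟨e, -, hRe, hdev⟩ := prob_ratioSum p q hA hB S
  set R := ratioMean p q A B S with hRdef
  -- The relation `√A B ε² = 10^7 n` turns the Cauchy-Schwarz bound, divided by `4n`, into this
  -- form. As `10^7/36 > 2·10^5`, the mean is at least twice the threshold.
  have hR : 10 ^ 7 / 36 * (A * √A * B) ≤ R := by
    have h1 := le_ratioMean p q hA hB S
    rw [← hRdef] at h1
    have h2 : (A * B * (ε / 3)) ^ 2 ≤ (A * B * ∑ i ∈ S, |mass p i - mass q i|) ^ 2 := by gcongr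
    have h3 := h2.trans h1
    have hR0 : 0 ≤ R := by
      by_contra hc
      have : R * (A + B + 2 * n) < 0 := mul_neg_of_neg_of_pos (not_le.1 hc) (by positivity)
      have : 0 ≤ (A * B * (ε / 3)) ^ 2 := sq_nonneg _
      linarith
    have h4 : R * (A + B + 2 * n) ≤ R * (4 * n) := by
      gcongr
      linarith [h.A_le_n, h.B_le_n]
    have h5 : (A * B * (ε / 3)) ^ 2 = 10 ^ 7 / 9 * (A * √A * B) * n := by
      calc (A * B * (ε / 3)) ^ 2 = A * B * (A * (B * ε ^ 2)) / 9 := by ring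
        _ = A * B * (√A ^ 2 * (B * ε ^ 2)) / 9 := by rw [hsq]
        _ = A * B * √A * (√A * B * ε ^ 2) / 9 := by ring
        _ = _ := by rw [h.rel]; ring
    rw [h5] at h3
    have h6 := h3.trans h4
    have : 10 ^ 7 / 9 * (A * √A * B) ≤ 4 * R := by
      refine le_of_mul_le_mul_right ?_ hn
      linarith
    linarith
  have hT0 : 0 < A * √A * B := by positivity
  have hR0 : 0 < R := lt_of_lt_of_le (by positivity) hR
  have he0 : 0 < e := hR0.trans_le hRe
  have h1 := hdev (e / 2) (half_pos he0)
  refine (measureReal_mono fun v hv => ?_).trans (h1.trans ?_)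
  · have : ratioSum A B S v ≤ τ := hv
    refine le_trans ?_ (neg_le_abs (_ : ℝ))
    have : 2 * τ ≤ e := by
      rw [hτ]; linarith
    linarith
  · have hRe2 : (R / 2) ^ 2 ≤ (e / 2) ^ 2 := by gcongr
    rw [div_le_iff₀ (by positivity)]
    refine le_trans ?_ (mul_le_mul_of_nonneg_left hRe2 (by norm_num))
    -- The budget for the variance is `(2/100)(R/2)² = 0.005 R²`; the null part takes half of it and
    -- the mean-dependent part at most `0.001 R²`.
    have k1 : 4 * (A * B) ^ 2 * (A + B) ≤ 25 / 10000 * R ^ 2 := by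
      have e1 : (10 ^ 7 / 36 * (A * √A * B)) ^ 2 = 10 ^ 14 / 1296 * ((A * B) ^ 2 * A) := by
        rw [mul_pow, mul_pow, mul_pow, hsq]; ring
      have e2 : (10 ^ 7 / 36 * (A * √A * B)) ^ 2 ≤ R ^ 2 := by gcongr
      rw [e1] at e2
      have := mul_le_mul_of_nonneg_left h.B_le (by positivity : 0 ≤ (A * B) ^ 2)
      have : 0 < (A * B) ^ 2 * A := by positivity
      nlinarith
    have k2 : 16 * (A + B) ^ 2 ≤ 1 / 1000 * R := by
      have a1 : A ^ 2 ≤ 4 / 10 ^ 7 * (A * √A * B) := by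
        have : √A ≤ 4 / 10 ^ 7 * B := by
          have h4 : ε ^ 2 ≤ 4 := by nlinarith [h.ε_le]
          have := h.rel
          have h5 : √A * B * ε ^ 2 ≤ √A * B * 4 := by gcongr
          have h6 : 10 ^ 7 * A ≤ √A * B * 4 := by linarith [h.A_le_n]
          have h7 : √A * (10 ^ 7 * √A) ≤ √A * (4 * B) := by nlinarith
          have := le_of_mul_le_mul_left h7 hsA
          linarith
        calc A ^ 2 = A * √A * √A := by nlinarith
          _ ≤ A * √A * (4 / 10 ^ 7 * B) := by gcongr
          _ = _ := by ring
      have a2 : B ^ 2 ≤ A * √A * B := by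
        have : (10 : ℝ) ^ 7 ≤ √A := by
          apply Real.le_sqrt_of_sq_le
          linarith [h.le_A]
        have : B ≤ A * √A := h.B_le.trans (by nlinarith)
        nlinarith
      nlinarith [sq_nonneg (A - B)]
    have := mul_le_mul_of_nonneg_right k2 hR0.le
    nlinarith

lemma sum_le_heavy_add_medium_add_light (f : Fin n → ℝ) (hf : ∀ i, 0 ≤ f i) :
    ∑ i, f i ≤ ∑ i ∈ heavy ε A B u, f i + ∑ i ∈ medium ε A B u, f i +
      ∑ i ∈ light ε A B u, f i := by
  classical
  have h1 : ∑ i ∈ heavy ε A B u ∪ medium ε A B u, f i ≤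
      ∑ i ∈ heavy ε A B u, f i + ∑ i ∈ medium ε A B u, f i := by
    rw [← Finset.sum_union_inter]
    have := Finset.sum_nonneg (s := heavy ε A B u ∩ medium ε A B u) fun i _ => hf i
    linarith
  have h2 := Finset.sum_sdiff (f := f) (Finset.subset_univ (heavy ε A B u ∪ medium ε A B u))
  have h3 : ∑ i ∈ light ε A B u, f i = ∑ i ∈ Finset.univ \ (heavy ε A B u ∪ medium ε A B u), f i := by
    unfold light; congr!
  linarith

/-- The test accepts, as a function of the counts in the first and second batches. -/
def AcceptsCounts (ε A B : ℝ) (u v : Fin n → ℕ × ℕ) : Prop :=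
  absSum A B (heavy ε A B u) v ≤ ε / 6 ∧
    quadSum A B (medium ε A B u) v ≤ ε ^ 2 * A ^ 2 * B * Real.log n / 2 ∧
    ratioSum A B (light ε A B u) v ≤ 10 ^ 5 * A ^ (3 / 2 : ℝ) * B

lemma prob_not_accepts (h : Regime n ε A B) (hu : TotalsOK A B u)
    (hu' : sqError p p A B u < thrB n ε B) :
    (pairLaw p p A B).real {v | ¬ AcceptsCounts ε A B u v} ≤ 4 / 100 := by
  have h1 := prob_absError_regime (p := p) (q := p) h (card_heavy_mul_le hu h)
  have h2 := prob_quadSum_null h (sum_medium_sq_le h hu')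
  have h3 := prob_ratioSum_null (p := p) h (light ε A B u)
  have hsub : {v | ¬ AcceptsCounts ε A B u v} ⊆
      ({v | ε / 12 ≤ absError p p A B (heavy ε A B u) v} ∪
        {v | ¬ quadSum A B (medium ε A B u) v ≤ ε ^ 2 * A ^ 2 * B * Real.log n / 2}) ∪
        {v | ¬ ratioSum A B (light ε A B u) v ≤ 10 ^ 5 * A ^ (3 / 2 : ℝ) * B} := by
    intro v hv
    by_contra hc
    simp only [Set.mem_union, Set.mem_ofPred_eq, not_or, not_le, not_lt] at hc
    refine hv ⟨?_, hc.1.2, hc.2⟩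
    have := absSum_le (A := A) (B := B) (p := p) (q := p) (heavy ε A B u) v
    simp only [sub_self, abs_zero, Finset.sum_const_zero] at this
    linarith [hc.1.1, h.ε_pos]
  have := (measureReal_mono (μ := pairLaw p p A B) hsub).trans (measureReal_union_le _ _)
  have := measureReal_union_le (μ := pairLaw p p A B)
    {v | ε / 12 ≤ absError p p A B (heavy ε A B u) v}
    {v | ¬ quadSum A B (medium ε A B u) v ≤ ε ^ 2 * A ^ 2 * B * Real.log n / 2}
  linarith

/-- Pigeonhole: some set carries at least `ε/3` of the distance, and passing its check alone is
already unlikely. -/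
lemma prob_accepts (h : Regime n ε A B) (hu : TotalsOK A B u)
    (hu' : sqError p q A B u < thrB n ε B) (hfar : ε ≤ ∑ i, |mass p i - mass q i|) :
    (pairLaw p q A B).real {v | AcceptsCounts ε A B u v} ≤ 4 / 100 := by
  have hs := hfar.trans (sum_le_heavy_add_medium_add_light (ε := ε) (A := A) (B := B) (u := u)
    (fun i => |mass p i - mass q i|) fun i => abs_nonneg _)
  rcases le_total (ε / 3) (∑ i ∈ heavy ε A B u, |mass p i - mass q i|) with hV | hV
  · have h1 := prob_absError_regime (p := p) (q := q) h (card_heavy_mul_le hu h)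
    refine (measureReal_mono fun v hv => ?_).trans (h1.trans (by norm_num))
    have := le_absSum (A := A) (B := B) (p := p) (q := q) (heavy ε A B u) v
    have h2 := hv.1
    show ε / 12 ≤ absError p q A B (heavy ε A B u) v
    linarith [h.ε_pos]
  rcases le_total (ε / 3) (∑ i ∈ medium ε A B u, |mass p i - mass q i|) with hW | hW
  · refine (measureReal_mono fun v hv => ?_).trans ((prob_quadSum_far h (sum_medium_sq_le h hu')
      (card_medium_mul_le hu h) hW).trans (by norm_num))
    exact hv.2.1
  · refine (measureReal_mono fun v hv => ?_).trans ((prob_ratioSum_far (S := light ε A B u) h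
      (by linarith)).trans (by norm_num))
    exact hv.2.2

end Test

/-! ### Verification of the parameter inequalities. -/

lemma regime_of_large {n : ℕ} {ε A : ℝ} (hn : (10 : ℝ) ^ 72 ≤ n)
    (hlog : 10 ^ 12 ≤ Real.log n) (hε : (n : ℝ) ^ (-(1 / 12) : ℝ) < ε) (hε2 : ε ≤ 2)
    (hA : (n : ℝ) ^ (2 / 3 : ℝ) / ε ^ (4 / 3 : ℝ) ≤ A) (hAn : A ≤ n) :
    Regime n ε A (10 ^ 7 * qRate n ε A) := by
  have hn0 : (0 : ℝ) < n := lt_of_lt_of_le (by norm_num) hn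
  have hε0 : 0 < ε := (Real.rpow_pos_of_pos hn0 _).trans hε
  have hA0 : 0 < A := lt_of_lt_of_le (by positivity) hA
  -- With `n = x^12` the hypotheses become `εx > 1` and `x^24 ≤ A³ε⁴`, and the remaining estimates
  -- become polynomial.
  set x : ℝ := (n : ℝ) ^ (1 / 12 : ℝ) with hx
  have hx0 : 0 < x := Real.rpow_pos_of_pos hn0 _
  have hx12 : x ^ 12 = n := by
    rw [hx, ← Real.rpow_natCast, ← Real.rpow_mul hn0.le]; norm_num
  have hx6 : 10 ^ 6 ≤ x := by
    rw [← pow_le_pow_iff_left₀ (by norm_num) hx0.le (by norm_num : 12 ≠ 0), hx12]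
    exact le_trans (by norm_num) hn
  have hεx : 1 < ε * x := by
    rw [Real.rpow_neg hn0.le, ← hx] at hε
    rwa [inv_lt_iff_one_lt_mul₀ hx0] at hε
  have hA3 : x ^ 24 ≤ A ^ 3 * ε ^ 4 := by
    rw [div_le_iff₀ (by positivity)] at hA
    have h1 := pow_le_pow_left₀ (by positivity) hA 3
    rw [mul_pow, ← Real.rpow_natCast ((n : ℝ) ^ (2 / 3 : ℝ)), ← Real.rpow_mul hn0.le,
      ← Real.rpow_natCast (ε ^ (4 / 3 : ℝ)), ← Real.rpow_mul hε0.le] at h1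
    have e1 : (2 / 3 : ℝ) * ((3 : ℕ) : ℝ) = ((2 : ℕ) : ℝ) := by norm_num
    have e2 : (4 / 3 : ℝ) * ((3 : ℕ) : ℝ) = ((4 : ℕ) : ℝ) := by norm_num
    rw [e1, e2, Real.rpow_natCast, Real.rpow_natCast, ← hx12] at h1
    calc x ^ 24 = (x ^ 12) ^ 2 := by ring
      _ ≤ _ := h1
  have hsA : 0 < √A := Real.sqrt_pos.2 hA0
  have hsq : √A ^ 2 = A := Real.sq_sqrt hA0.le
  -- The first entry of the maximum dominates since `A ≤ n`.
  have hrate : qRate n ε A = n / (√A * ε ^ 2) := by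
    rw [qRate, max_eq_left]
    rw [div_le_div_iff₀ (by positivity) (by positivity)]
    have h1 : √A ≤ √n := Real.sqrt_le_sqrt hAn
    have h2 : √(n : ℝ) * √n = n := Real.mul_self_sqrt hn0.le
    calc √(n : ℝ) * (√A * ε ^ 2) ≤ √n * (√n * ε ^ 2) := by gcongr
      _ = √n * √n * ε ^ 2 := by ring
      _ = n * ε ^ 2 := by rw [h2]
  rw [hrate]
  set B : ℝ := 10 ^ 7 * (n / (√A * ε ^ 2)) with hB
  have hB0 : 0 < B := by positivity
  have hrel : √A * B * ε ^ 2 = 10 ^ 7 * n := by rw [hB]; field_simp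
  have hrel2 : A * B ^ 2 * ε ^ 4 = 10 ^ 14 * x ^ 24 := by
    calc A * B ^ 2 * ε ^ 4 = √A ^ 2 * B ^ 2 * ε ^ 4 := by rw [hsq]
      _ = (√A * B * ε ^ 2) ^ 2 := by ring
      _ = _ := by rw [hrel, ← hx12]; ring
  have hε4 : ε ^ 4 ≤ 16 := by
    calc ε ^ 4 ≤ 2 ^ 4 := by gcongr
      _ = 16 := by norm_num
  have hx24 : ((10 : ℝ) ^ 6) ^ 24 ≤ x ^ 24 := by gcongr
  have hx16 : ((10 : ℝ) ^ 6) ^ 16 ≤ x ^ 16 := by gcongr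
  have hx12' : ((10 : ℝ) ^ 6) ^ 12 ≤ x ^ 12 := by gcongr
  have hBlow : 10 ^ 7 * x ^ 6 ≤ B * ε ^ 2 := by
    have h1 : 10 ^ 14 * x ^ 24 ≤ x ^ 12 * (B ^ 2 * ε ^ 4) := by
      rw [← hrel2, mul_assoc, hx12]; gcongr
    have h2 : x ^ 12 * (10 ^ 14 * x ^ 12) ≤ x ^ 12 * (B ^ 2 * ε ^ 4) := by
      refine le_trans (le_of_eq ?_) h1; ring
    have h3 := le_of_mul_le_mul_left h2 (by positivity)
    rw [← pow_le_pow_iff_left₀ (by positivity) (by positivity) (by norm_num : 2 ≠ 0)]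
    calc (10 ^ 7 * x ^ 6) ^ 2 = 10 ^ 14 * x ^ 12 := by ring
      _ ≤ _ := h3
      _ = _ := by ring
  have hBA : B ≤ 10 ^ 7 * A := by
    rw [← pow_le_pow_iff_left₀ hB0.le (by positivity) (by norm_num : 2 ≠ 0)]
    refine le_of_mul_le_mul_left (a := A * ε ^ 4) ?_ (by positivity)
    calc A * ε ^ 4 * B ^ 2 = 10 ^ 14 * x ^ 24 := by rw [← hrel2]; ring
      _ ≤ 10 ^ 14 * (A ^ 3 * ε ^ 4) := by gcongr
      _ = _ := by ring
  have hℓ0 : 0 < Real.log n := by linarith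
  refine ⟨?_, ?_, hε0, hε2, hBA, hlog, ?_, hAn, ?_, hrel⟩
  · by_contra! hc
    have h1 : A ^ 3 ≤ (10 ^ 14) ^ 3 := by gcongr
    have h2 : A ^ 3 * ε ^ 4 ≤ (10 ^ 14) ^ 3 * 16 := by gcongr
    have := hx24.trans (hA3.trans h2)
    norm_num at this
  · by_contra! hc
    have h1 : B * ε ^ 2 ≤ 400 * 2 ^ 2 := by gcongr
    have h2 : ((10 : ℝ) ^ 6) ^ 6 ≤ x ^ 6 := by gcongr
    have := (mul_le_mul_of_nonneg_left h2 (by norm_num : (0 : ℝ) ≤ 10 ^ 7)).trans (hBlow.trans h1)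
    norm_num at this
  · have hx2 : (10 ^ 6) ^ 2 ≤ x ^ 2 := by gcongr
    -- The noise bound for `W` needs `Bε⁶` large: the lower bound `Bε² ≥ 10^7 √n` absorbs the loss
    -- of `ε⁴ > x⁻⁴`.
    have hBε : 10 ^ 7 * x ^ 2 ≤ B * ε ^ 6 := by
      have h1 : 1 ≤ (ε * x) ^ 4 := one_le_pow₀ hεx.le
      refine le_of_mul_le_mul_right (a := x ^ 4) ?_ (by positivity)
      calc 10 ^ 7 * x ^ 2 * x ^ 4 = 10 ^ 7 * x ^ 6 * 1 := by ring
        _ ≤ B * ε ^ 2 * (ε * x) ^ 4 := by gcongr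
        _ = _ := by ring
    have hBε' : 10 ^ 19 ≤ B * ε ^ 6 := by
      refine le_trans ?_ hBε
      linarith
    have hAB : A + B ≤ (10 ^ 7 + 1) * A := by linarith
    have hs : √(8 * thrB n ε B) * (10 ^ 7 + 1) ≤ ε ^ 2 * Real.log n / 2 / 1000 := by
      rw [← le_div_iff₀ (by norm_num)]
      rw [Real.sqrt_le_left (by positivity)]
      unfold thrB
      rw [mul_div_assoc', div_le_iff₀ (by positivity)]
      have h1 : 10 ^ 19 * Real.log n ≤ B * ε ^ 6 * Real.log n := by gcongr
      have h2 : Real.log n * (10 ^ 19 * Real.log n) ≤ Real.log n * (B * ε ^ 6 * Real.log n) := by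
        gcongr
      have h3 : Real.log n * 10 ^ 12 ≤ Real.log n * Real.log n := by gcongr
      have e : (ε ^ 2 * Real.log n / 2 / 1000 / (10 ^ 7 + 1)) ^ 2 * (ε ^ 2 * B) =
          Real.log n * (B * ε ^ 6 * Real.log n) / (2000 * (10 ^ 7 + 1)) ^ 2 := by ring
      rw [e, le_div_iff₀ (by norm_num)]
      linarith
    calc A * B * (A + B) * √(8 * thrB n ε B)
        ≤ A * B * ((10 ^ 7 + 1) * A) * √(8 * thrB n ε B) := by gcongr
      _ = A ^ 2 * B * (√(8 * thrB n ε B) * (10 ^ 7 + 1)) := by ring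
      _ ≤ A ^ 2 * B * (ε ^ 2 * Real.log n / 2 / 1000) := by gcongr
      _ = _ := by ring
  · have hAε : 10 ^ 14 ≤ A * ε ^ 4 := by
      by_contra! hc
      have h1 : (A * ε ^ 4) ^ 3 ≤ (10 ^ 14) ^ 3 := by gcongr
      have h2 : x ^ 16 ≤ (A * ε ^ 4) ^ 3 := by
        have h3 : 1 ≤ (ε * x) ^ 8 := one_le_pow₀ hεx.le
        calc x ^ 16 = x ^ 16 * 1 := by ring
          _ ≤ x ^ 16 * (ε * x) ^ 8 := by gcongr
          _ = x ^ 24 * ε ^ 8 := by ring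
          _ ≤ A ^ 3 * ε ^ 4 * ε ^ 8 := by gcongr
          _ = _ := by ring
      have := hx16.trans (h2.trans h1)
      norm_num at this
    rw [← pow_le_pow_iff_left₀ hB0.le hn0.le (by norm_num : 2 ≠ 0), ← hx12]
    have h1 : 10 ^ 14 * B ^ 2 ≤ A * ε ^ 4 * B ^ 2 := by gcongr
    have h2 : A * ε ^ 4 * B ^ 2 = 10 ^ 14 * x ^ 24 := by rw [← hrel2]; ring
    have h3 : (x ^ 12) ^ 2 = x ^ 24 := by ring
    linarith

/-! ### Conditioning on the first batches and assembly. -/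

/-- Fubini: a bad first coordinate costs at most `a`, and each good one leaves conditional failure
probability at most `b`. -/
lemma prod_real_compl_le {X : Type*} [MeasurableSpace X] [Countable X]
    [MeasurableSingletonClass X] {P : Measure X} [IsProbabilityMeasure P] {G : Set X}
    {E : Set (X × X)} {a b : ℝ} (hb : 0 ≤ b) (hG : P.real Gᶜ ≤ a)
    (hE : ∀ u ∈ G, P.real {v | (u, v) ∉ E} ≤ b) : (P.prod P).real Eᶜ ≤ a + b := by
  have h1 : (P.prod P) Eᶜ ≤ P Gᶜ + ENNReal.ofReal b := by
    rw [Measure.prod_apply .of_discrete]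
    calc ∫⁻ u, P (Prod.mk u ⁻¹' Eᶜ) ∂P
        ≤ ∫⁻ u, (Gᶜ.indicator 1 u + ENNReal.ofReal b) ∂P := by
          refine lintegral_mono fun u => ?_
          by_cases hu : u ∈ G
          · have : P (Prod.mk u ⁻¹' Eᶜ) ≤ ENNReal.ofReal b := by
              rw [← ofReal_measureReal]
              exact ENNReal.ofReal_le_ofReal (hE u hu)
            exact this.trans le_add_self
          · have hu' : u ∈ Gᶜ := hu
            rw [Set.indicator_of_mem hu']
            exact prob_le_one.trans le_self_add
      _ = _ := by
          rw [lintegral_add_right _ measurable_const, lintegral_indicator_one .of_discrete]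
          simp
  have h2 : P Gᶜ + ENNReal.ofReal b ≠ ∞ := by finiteness
  calc (P.prod P).real Eᶜ ≤ (P Gᶜ + ENNReal.ofReal b).toReal := ENNReal.toReal_mono h2 h1
    _ = P.real Gᶜ + b := by
        rw [ENNReal.toReal_add (by finiteness) (by finiteness), ENNReal.toReal_ofReal hb]; rfl
    _ ≤ a + b := by linarith

/-- The requirements on the test, in terms of the counts. -/
def Succeeds {n : ℕ} (ε A B : ℝ) (p q : PMF (Fin n)) (u v : Fin n → ℕ × ℕ) : Prop :=
  TotalsOK A B u ∧ TotalsOK A B v ∧ (p = q → AcceptsCounts ε A B u v) ∧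
    (ε ≤ l1Dist p q → ¬ AcceptsCounts ε A B u v)

lemma prob_succeeds {n : ℕ} {ε A B : ℝ} (h : Regime n ε A B) (p q : PMF (Fin n)) :
    2 / 3 ≤ ((pairLaw p q A B).prod (pairLaw p q A B)).real
      {z | Succeeds ε A B p q z.1 z.2} := by
  set P := pairLaw p q A B with hP
  set G : Set (Fin n → ℕ × ℕ) := {u | TotalsOK A B u ∧ sqError p q A B u < thrB n ε B} with hG
  have h1 : P.real Gᶜ ≤ 3 / 100 := by
    have hsub : Gᶜ ⊆ {u | ¬ TotalsOK A B u} ∪ {u | thrB n ε B ≤ sqError p q A B u} := by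
      intro u hu
      by_contra hc
      simp only [Set.mem_union, Set.mem_ofPred_eq, not_or, not_not, not_le] at hc
      exact hu hc
    have := (measureReal_mono (μ := P) hsub).trans (measureReal_union_le _ _)
    have := prob_not_totalsOK (p := p) (q := q) h
    have := prob_sqError_regime (p := p) (q := q) h
    linarith
  have h2 : ∀ u ∈ G, P.real {v | (u, v) ∉ {z : (Fin n → ℕ × ℕ) × (Fin n → ℕ × ℕ) |
      Succeeds ε A B p q z.1 z.2}} ≤ 6 / 100 := by
    intro u hu
    have hT := prob_not_totalsOK (p := p) (q := q) h
    obtain ⟨T, hT4, hTv⟩ : ∃ T : Set (Fin n → ℕ × ℕ), P.real T ≤ 4 / 100 ∧ ∀ v ∉ T,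
        (p = q → AcceptsCounts ε A B u v) ∧ (ε ≤ l1Dist p q → ¬ AcceptsCounts ε A B u v) := by
      by_cases hpq : p = q
      · subst hpq
        refine ⟨_, prob_not_accepts h hu.1 hu.2, fun v hv => ⟨fun _ => not_not.1 hv, fun hf => ?_⟩⟩
        simp only [l1Dist, sub_self, abs_zero, Finset.sum_const_zero] at hf
        exact absurd h.ε_pos (not_lt.2 hf)
      by_cases hf : ε ≤ l1Dist p q
      · exact ⟨_, prob_accepts h hu.1 hu.2 hf, fun v hv => ⟨fun h => absurd h hpq, fun _ => hv⟩⟩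
      · exact ⟨∅, by norm_num, fun v _ => ⟨fun h => absurd h hpq, fun h => absurd h hf⟩⟩
    have hsub : {v | (u, v) ∉ {z : (Fin n → ℕ × ℕ) × (Fin n → ℕ × ℕ) |
        Succeeds ε A B p q z.1 z.2}} ⊆ {v | ¬ TotalsOK A B v} ∪ T := by
      intro v hv
      by_contra hc
      simp only [Set.mem_union, Set.mem_ofPred_eq, not_or, not_not] at hc
      exact hv ⟨hu.1, hc.1, hTv v hc.2⟩
    have := (measureReal_mono (μ := P) hsub).trans (measureReal_union_le _ _)
    linarith
  -- Total failure probability at most `3/100 + 6/100`, well below `1/3`.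
  have h3 := prod_real_compl_le (by norm_num) h1 h2
  rw [probReal_compl_eq_one_sub .of_discrete] at h3
  linarith

lemma Succeeds.of_data {n : ℕ} {ε A B : ℝ} {p q : PMF (Fin n)} {ω : Samples n}
    (h : Succeeds ε A B p q ω.data.1 ω.data.2) :
    (A ≤ (ω.numP : ℝ) ∧ (ω.numP : ℝ) ≤ 3 * A ∧ (ω.numQ : ℝ) ≤ 3 * B) ∧
      (p = q → Accepts (10 ^ 5) ε A B ω) ∧ (ε ≤ l1Dist p q → ¬ Accepts (10 ^ 5) ε A B ω) := by
  obtain ⟨hu, hv, h⟩ := h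
  have hlen : ∀ l : List (Fin n), ∑ i, (counts l i : ℝ) = l.length := fun l => by
    exact_mod_cast sum_counts l
  simp only [TotalsOK, Samples.data, hlen, abs_lt] at hu hv
  refine ⟨?_, h⟩
  simp only [Samples.numP, Samples.numQ, Nat.cast_add]
  -- Each batch from `p` has size between `A/2` and `3A/2`, so two batches give exactly the range
  -- from `A` to `3A`.
  refine ⟨?_, ?_, ?_⟩ <;> linarith [hu.1.1, hu.1.2, hv.1.1, hv.1.2, hu.2.2, hv.2.2]

end ClosenessTest

theorem mainTheorem2 :
    ∃ C₂ : ℝ, 0 < C₂ ∧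
    ∀ γ : ℝ, 0 < γ → ∃ Cγ : ℝ, 0 < Cγ ∧
    ∀ K : ℝ, 0 < K → ∃ n₀ : ℕ,
    ∀ (n : ℕ) (ε m₁ m₂ : ℝ), n₀ ≤ n →
      (n : ℝ) ^ (-(1 / 12) : ℝ) < ε → ε ≤ 2 →
      (n : ℝ) ^ (2 / 3 : ℝ) / ε ^ (4 / 3 : ℝ) ≤ m₁ →
      m₁ ≤ K * ((n : ℝ) / ε ^ 2) ^ (1 - γ) → m₁ ≤ n →
      m₂ = C₂ * ClosenessTest.qRate n ε m₁ →
    ∀ p q : PMF (Fin n),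
      2 / 3 ≤ ClosenessTest.prob (ClosenessTest.samplesLaw p q m₁ m₂)
        {ω | (m₁ ≤ (ω.numP : ℝ) ∧ (ω.numP : ℝ) ≤ 3 * m₁ ∧ (ω.numQ : ℝ) ≤ 3 * m₂) ∧
          (p = q → ClosenessTest.Accepts Cγ ε m₁ m₂ ω) ∧
          (ε ≤ ClosenessTest.l1Dist p q → ¬ ClosenessTest.Accepts Cγ ε m₁ m₂ ω)} := by
  -- The sample-size constant `10^7` is chosen so that the mean of `Z` in the far case is at least
  -- twice the threshold with constant `10^5`.
  refine ⟨10 ^ 7, by norm_num, fun γ _ => ⟨10 ^ 5, by norm_num, fun K _ =>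
    ⟨max (10 ^ 72) ⌈Real.exp (10 ^ 12)⌉₊, ?_⟩⟩⟩
  rintro n ε m₁ _ hn hε hε2 hm₁ - hm₁n rfl p q
  have hn1 : (10 : ℝ) ^ 72 ≤ n := by exact_mod_cast (le_max_left _ _).trans hn
  have hn2 : Real.exp (10 ^ 12) ≤ n :=
    (Nat.le_ceil _).trans (by exact_mod_cast (le_max_right _ _).trans hn)
  have hlog : 10 ^ 12 ≤ Real.log n := by
    rwa [Real.le_log_iff_exp_le ((Real.exp_pos _).trans_le hn2)]
  have h := ClosenessTest.prob_succeeds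
    (ClosenessTest.regime_of_large hn1 hlog hε hε2 hm₁ hm₁n) p q
  have h2 : (2 / 3 : ℝ≥0∞) = ENNReal.ofReal (2 / 3) := by
    rw [ENNReal.ofReal_div_of_pos (by norm_num)]; simp
  rw [h2]
  refine (ENNReal.ofReal_le_ofReal h).trans ?_
  rw [ofReal_measureReal, ← ClosenessTest.prob_samplesLaw]
  exact measure_mono fun ω hω => ClosenessTest.Succeeds.of_data hω
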